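/- **Setting.** There are two parallel theories. *Discrete*: exponents range over $\Gamma=\mathbb Z$ and coefficients over a field $K$ of characteristic $0$. *Continuous*: $\Gamma=\mathbb R$, $K=\mathbb C$. An *Artinian operator* is a formal series $g(D)=\sum_{a\in\Gamma}g_aD^a$ with well-ordered support; sums of Artinian operators "converge" when the union of the supports is well ordered and each power of $D$ occurs in finitely many terms. A *delta operator* is one of degree (lowest exponent) $1$; $f'$ denotes the image of $f$ under $D^a\mapsto aD^{a-1}$. The Roman factorial is $\lfloor a\rceil!=\Gamma(a+1)$ if $a$ is not a negative integer and $\lfloor a\rceil!=(-1)^{a+1}/(-a-1)!$ otherwise; $\lfloor a\rceil=a$ for $a\ne0$ and $\lfloor0\rceil=1$. For a finitely supported integer sequence $\alpha=(\alpha_1,\alpha_2,\dots)$ put $\ell^\alpha=(\log x)^{\alpha_1}(\log\log x)^{\alpha_2}\cdots$, and write $(0)=(0,0,\dots)$, $(1)=(1,0,0,\dots)$. The harmonic logarithms are $\lambda_a^\alpha(x)=\lfloor a\rceil!\,x^a\sum_{k\ge0}s(-a,k)\,(x\,d/dx)^k\ell^\alpha$, where $\sum_k s(-a,k)\varepsilon^k=\Gamma(1+\varepsilon)/\Gamma(1+\varepsilon+a)$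 (so $\lambda_a^{(0)}=x^a$, or $0$ if $a$ is a negative integer). $\mathcal I^\alpha$ is the space of formal sums $\sum_b c_b\lambda_b^\alpha$ with reverse-well-ordered support; $\langle p\rangle_\alpha$ is the coefficient of $\lambda_0^\alpha$ in $p\in\mathcal I^\alpha$; operators act termwise by $D^a\lambda_b^\alpha=\frac{\lfloor b\rceil!}{\lfloor b-a\rceil!}\lambda_{b-a}^\alpha$. A (regular) *graded sequence* is a family $p_a^\alpha=\sum_{b\le a}c_{ab}\lambda_b^\alpha$ with $c_{aa}\neq0$ and $c_{ab}$ independent of $\alpha$. *Powers and associated sequences.* In the discrete case $f^b$ is the usual power, and $p$ is *associated* with the delta operator $f$ if it is a graded sequence with $\langle p_a^\alpha\rangle_\alpha=\delta_{a0}$ for all $\alpha$ and $f(D)p_a^\alpha=\lfloor a\rceil p_{a-1}^\alpha$ for $\alpha\ne(0)$. In the continuous case, for $f=cD^d(1+u)$ with $c\neq0$ and $u$ of positive degree and $n\in\mathbb Z$, $f^{a;n}=e^{a(\log c+2\pi i n)}D^{ad}(1+u)^a$ (principal logarithm, binomial series), and $p$ is *$n$-th associated* with the delta operator $f$ if it is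 a graded sequence with $\langle p_a^\alpha\rangle_\alpha=\delta_{a0}$ for all $\alpha$ and $f^{b;n}p_a^\alpha=\frac{\lfloor a\rceil!}{\lfloor a-b\rceil!}p_{a-b}^\alpha$ for all $b$ and all $\alpha\neq(0)$. *Inverse.* In the continuous case $f^{(-1;n)}$ is a delta operator $h$ together with a branch $m\in\mathbb Z$ such that the $m$-th logarithm of the leading coefficient of $h$ is minus the $n$-th logarithm of that of $f$, and $\sum_a h_af^{a;n}=D=\sum_a f_ah^{a;m}$. Powers of $f^{(-1;n)}$ are $h^{a;m}$, and $g(f^{(-1;n)})=\sum_a g_ah^{a;m}$. In the discrete case $f^{(-1)}$ is the delta operator $h$ with $\sum_a h_af^a=D=\sum_a f_ah^a$, and $g(f^{(-1)})=\sum_a g_ah^a$. **Proposition.** Let $f(D)$ be a delta operator (and, in the continuous case, $n\in\mathbb Z$). Then $f^{(-1;n)}$ exists and is unique, and for every Artinian operator $g(D)$ the sum defining $g(f^{(-1;n)})$ converges. (In the discrete case read $f^{(-1)}$ for $f^{(-1;n)}$, and drop "$;n$" and "$n$-th".) If $p$ is the ($n$-th) associated graded sequence of $f(D)$, then: 1.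 for every Artinian $g(D)$ and every $\alpha\ne(0)$ there is a convergent expansion $$g(f^{(-1;n)})=\sum_b\frac{\langle g(D)p_b^\alpha\rangle_\alpha}{\lfloor b\rceil!}D^b;$$ 2. the same holds for $\alpha=(0)$ whenever $g(D)$ contains only powers $D^a$ with $a\ge0$, in particular for every differential operator $g(D)$ (power series in $D$); 3. $\langle g(D)p_b^\alpha\rangle_\alpha=\langle g(f^{(-1;n)})\lambda_b^\alpha\rangle_\alpha$ for all $b$ and all $\alpha\ne(0)$, and $\lfloor b\rceil!\,\langle g(D)f'(D)f(D)^{-1-b;n}\lambda_{-1}^{(1)}\rangle_{(1)}=\langle g(D)p_b^{(1)}\rangle_{(1)}$ for all $b$; 4. for every $a$, there is a convergent expansion $$f^{(-1;n)}(D)^a=\sum_b\frac{\langle D^ap_b^{(1)}\rangle_{(1)}}{\lfloor b\rceil!}D^b.$$ Moreover, for every delta operator $f(D)$ and every Artinian operator $g(D)$ there are convergent expansions $$g(f^{(-1;n)})=\sum_a\langle g(D)f'(D)f(D)^{-1-a;n}\lambda_{-1}^{(1)}\rangle_{(1)}D^a,\qquad g(f^{(-1;n)})=\sum_b\frac{\langle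 g(f^{(-1;n)})\lambda_b^\alpha\rangle_\alpha}{\lfloor b\rceil!}D^b\quad(\alpha\ne(0)).$$ -/

import Mathlib

noncomputable section

namespace RomanLog

/-! Exponents lie in `Γ` (`ℤ` in the discrete theory, `ℝ` in the continuous theory) and
coefficients in `K` (a field of characteristic zero, respectively `ℂ`). -/

/-- Artinian operators: formal series `∑ₐ cₐ Dᵃ` with well-ordered support. -/
abbrev Op (Γ K : Type*) [PartialOrder Γ] [Zero K] := HahnSeries Γ K

/-- The exponent vector `α = (α₁, α₂, …)` of the iterated logarithms: `α j` is the exponent of the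
`(j+1)`-fold iterated logarithm of `x`. -/
abbrev LogIndex := ℕ →₀ ℤ

/-- The index `(1) = (1, 0, 0, …)`. -/
def one : LogIndex := Finsupp.single 0 1

/-- Formal expressions `∑ F a γ · xᵃ (log x)^γ₁ (log log x)^γ₂ ⋯`, given by their coefficients. -/
abbrev LogExpr (Γ K : Type*) := Γ → LogIndex → K

/-- The two numerical functions that differ between the discrete and the continuous theory:
the Roman factorial `⌊a⌉!`, and `stirling a k`, the Stirling number of the first kind `s(-a, k)`,
i.e. the coefficient of `εᵏ` in `Γ(1 + ε) / Γ(1 + ε + a)`. Only the two instances below are used. -/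
class Scale (Γ K : Type*) where
  rfac : Γ → K
  stirling : Γ → ℕ → K

/-- The Roman factorial on integers: `n!` for `n ≥ 0` and `(-1)^(n+1) / (-n-1)!` for `n < 0`. -/
def rfacInt (K : Type*) [Field K] (n : ℤ) : K :=
  if 0 ≤ n then (n.toNat.factorial : K) else (-1) ^ (n + 1) / ((-n - 1).toNat.factorial : K)

/-- The power series `Γ(1 + ε) / Γ(1 + ε + n)` for an integer `n`, namely
`1 / ((ε + 1) ⋯ (ε + n))` for `n ≥ 0` and `ε (ε - 1) ⋯ (ε + n + 1)` for `n < 0`. -/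
def gammaQuotInt (K : Type*) [Field K] (n : ℤ) : PowerSeries K :=
  (∏ i ∈ Finset.range n.toNat, (PowerSeries.X + PowerSeries.C ((i : K) + 1)))⁻¹ *
    ∏ i ∈ Finset.range (-n).toNat, (PowerSeries.X - PowerSeries.C (i : K))

open Classical in
/-- The Roman factorial on reals: `Γ(a + 1)` unless `a` is a negative integer. -/
def rfacReal (a : ℝ) : ℂ :=
  if ∃ n : ℤ, n < 0 ∧ (n : ℝ) = a then rfacInt ℂ ⌊a⌋ else Complex.Gamma (a + 1)

instance (K : Type*) [Field K] : Scale ℤ K where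
  rfac := rfacInt K
  stirling n k := PowerSeries.coeff k (gammaQuotInt K n)

instance : Scale ℝ ℂ where
  rfac := rfacReal
  stirling a k :=
    iteratedDeriv k (fun ε : ℂ => Complex.Gamma (1 + ε) / Complex.Gamma (1 + ε + a)) 0
      / (k.factorial : ℂ)

/-- The derivation `∂ = x d/dx` on finite sums of products of iterated logarithms:
`∂ ℓ^γ = ∑ⱼ γⱼ ℓ^(γ - e₀ - ⋯ - eⱼ)`. -/
def xDeriv (K : Type*) [Field K] : (LogIndex →₀ K) →ₗ[K] (LogIndex →₀ K) :=
  Finsupp.linearCombination K fun γ : LogIndex =>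
    ∑ j ∈ γ.support,
      Finsupp.single (γ - ∑ i ∈ Finset.range (j + 1), Finsupp.single i (1 : ℤ)) ((γ j : ℤ) : K)

section Series

variable {Γ K : Type*} [CommRing Γ] [LinearOrder Γ] [IsStrictOrderedRing Γ]
  [Field K] [Algebra Γ K] [Scale Γ K]

/-- `⌊a⌉!` -/
def rfac (K : Type*) {Γ : Type*} [Scale Γ K] (a : Γ) : K := Scale.rfac a

/-- The harmonic logarithm `λ_a^α(x) = ⌊a⌉! xᵃ ∑ₖ s(-a, k) ∂ᵏ ℓ^α`. (For a given monomial at most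
one `k` contributes.) It is `xᵃ` or `0` for `α = (0)`, according as `a` is not, or is, a negative
integer. -/
def harmLog (α : LogIndex) (a : Γ) : LogExpr Γ K := fun b γ =>
  if b = a then
    rfac K a * ∑ᶠ k : ℕ, (Scale.stirling a k : K) * ((xDeriv K)^[k] (Finsupp.single α 1)) γ
  else 0

/-- The formal sum `∑_b c_b λ_b^α(x)` (each monomial occurs in a single term). -/
def expand (α : LogIndex) (c : Γ → K) : LogExpr Γ K := fun a γ =>
  ∑ᶠ b : Γ, c b * harmLog α b a γ

/-- The Noetherian condition: no infinite ascending chain of exponents. -/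
def IsNoetherian (c : Γ → K) : Prop := (Function.support c).WellFoundedOn (· > ·)

/-- `p = ∑_b c_b λ_b^α(x)` is an element of `𝓘^α`, with coefficients `c_b` (taken to be zero where
`λ_b^α = 0`). -/
def IsExpansion (α : LogIndex) (c : Γ → K) (p : LogExpr Γ K) : Prop :=
  IsNoetherian c ∧ (∀ b, harmLog (K := K) α b = 0 → c b = 0) ∧ p = expand α c

open Classical in
/-- The coefficients `[λ_b^α(x)] p(x)` of an element `p` of `𝓘^α`. -/
def coords (α : LogIndex) (p : LogExpr Γ K) : Γ → K :=
  if h : ∃ c, IsExpansion α c p then h.choose else 0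

/-- The augmentation `⟨p⟩_α`: the coefficient of `λ_0^α` in `p`. -/
def aug (α : LogIndex) (p : LogExpr Γ K) : K := coords α p 0

/-- The action of an Artinian operator on `𝓘^α`: the termwise extension of
`Dᵃ λ_b^α = (⌊b⌉! / ⌊b - a⌉!) λ_(b-a)^α`. -/
def act (α : LogIndex) (g : Op Γ K) (p : LogExpr Γ K) : LogExpr Γ K :=
  expand α fun e =>
    ∑ᶠ a : Γ, g.coeff a * coords α p (e + a) * (rfac K (e + a) / rfac K e)

/-- A (regular) graded sequence: `p_a^α ∈ 𝓘^α` has degree `a`, with coefficients that do not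
depend on `α`. -/
def IsGraded (p : LogIndex → Γ → LogExpr Γ K) : Prop :=
  ∃ c : Γ → Γ → K,
    (∀ a, IsNoetherian (c a) ∧ c a a ≠ 0 ∧ ∀ b, a < b → c a b = 0) ∧
    ∀ α a, p α a = expand α (c a)

/-- `⟨p_a^α⟩_α = δ_{a0}`. -/
def IsNormalized (p : LogIndex → Γ → LogExpr Γ K) : Prop :=
  ∀ α, aug α (p α 0) = 1 ∧ ∀ a, a ≠ 0 → aug α (p α a) = 0

/-- Delta operators: Artinian operators of degree one. -/
def IsDelta (f : Op Γ K) : Prop := f ≠ 0 ∧ f.order = 1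

/-- The operator `D`. -/
def D : Op Γ K := HahnSeries.single 1 1

/-- The Pincherle derivative `Dᵃ ↦ a Dᵃ⁻¹`. -/
def pincherle (f : Op Γ K) : Op Γ K where
  coeff b := algebraMap Γ K (b + 1) * f.coeff (b + 1)
  isPWO_support' := by
    refine (f.isPWO_support.image_of_monotone (f := fun a => a - 1) ?_).mono ?_
    · intro a b h
      exact sub_le_sub_right h 1
    · intro b hb
      refine ⟨b + 1, ?_, by simp⟩
      exact right_ne_zero_of_mul hb

/-- The family `s` of Artinian series is summable, with sum `F`. -/
def HasHSum {ι : Type*} (s : ι → Op Γ K) (F : Op Γ K) : Prop :=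
  ∃ t : HahnSeries.SummableFamily Γ K ι, (∀ i, t i = s i) ∧ t.hsum = F

/-- `F = ∑ₐ gₐ fᵃ`, where `P a` is the power `fᵃ`. -/
def IsComp (g : Op Γ K) (P : Γ → Op Γ K) (F : Op Γ K) : Prop :=
  HasHSum (fun a => g.coeff a • P a) F

end Series

/-! Discrete theory -/

/-- `p` is the associated graded sequence of `f(D)`, discrete case; here `⌊a⌉ = a` for `a ≠ 0` and
`⌊0⌉ = 1`. -/
def IsAssociatedDiscrete {K : Type*} [Field K] (f : Op ℤ K)
    (p : LogIndex → ℤ → LogExpr ℤ K) : Prop :=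
  IsGraded p ∧ IsNormalized p ∧
    ∀ α, α ≠ 0 → ∀ a : ℤ, act α f (p α a) = (if a = 0 then (1 : K) else (a : K)) • p α (a - 1)

/-- `h = f^{(-1)}`. -/
def IsInverseDiscrete {K : Type*} [Field K] (f h : Op ℤ K) : Prop :=
  IsDelta h ∧ IsComp h (fun a => f ^ a) D ∧ IsComp f (fun a => h ^ a) D

/-! Continuous theory -/

/-- The `n`-th branch of the logarithm of the leading coefficient of `f`. -/
def leadLog (f : Op ℝ ℂ) (n : ℤ) : ℂ :=
  Complex.log f.leadingCoeff + 2 * Real.pi * Complex.I * n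

/-- The power `f^{a;n}`: if `f = c Dᵈ (1 + u)` with `u` of positive degree, it is
`exp(a (log c + 2πin)) D^{ad} (1 + u)ᵃ`, the last factor being the binomial series. -/
def rpow (f : Op ℝ ℂ) (n : ℤ) (a : ℝ) : Op ℝ ℂ :=
  HahnSeries.single (a * f.order) (Complex.exp (a * leadLog f n)) *
    PowerSeries.heval (HahnSeries.single (-f.order) (f.leadingCoeff)⁻¹ * f - 1)
      (PowerSeries.binomialSeries ℂ (a : ℂ))

/-- `p` is the `n`-th associated graded sequence of `f(D)`, continuous case. -/
def IsAssociated (f : Op ℝ ℂ) (n : ℤ) (p : LogIndex → ℝ → LogExpr ℝ ℂ) : Prop :=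
  IsGraded p ∧ IsNormalized p ∧
    ∀ α, α ≠ 0 → ∀ a b : ℝ,
      act α (rpow f n b) (p α a) = (rfac ℂ a / rfac ℂ (a - b)) • p α (a - b)

/-- `h = f^{(-1;n)}`, together with the branch `m` that its powers must use: `h` is the inverse of `f`
for substitution, `h(f;n) = D` and `f(h;m) = D`, and the `m`-th logarithm of the leading coefficient
of `h` is the negative of the `n`-th logarithm of the leading coefficient of `f`. The substitution
`g(f^{(-1;n)})` is `∑ gₐ h^{a;m}`. -/
def IsInverse (f : Op ℝ ℂ) (n : ℤ) (h : Op ℝ ℂ) (m : ℤ) : Prop :=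
  IsDelta h ∧ leadLog h m = -leadLog f n ∧ IsComp h (rpow f n) D ∧ IsComp f (rpow h m) D

end RomanLog

end

/-! Encode `∑ c_e λ_e^α` by the series `C` with `C_{-e} = ⌊e⌉! c_e`. This absorbs the Roman
factorials in the action of `Dᵃ`: for `α ≠ (0)`, where no `λ_e^α` vanishes, `g(D)` acts as
multiplication by `g`, and the augmentation is the constant term. A graded sequence becomes one
family `C_b` serving all `α`, and association with `f` yields `[D⁰] fᵏ C_b = ⌊b⌉! δ_{kb}`: up to
factorials, the `C_b` are dual to the powers of `f`. If `γ = g(f^{(-1)})`, then `g = ∑ γ_k fᵏ`, and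
pairing with `C_b` gives `⟨g p_b⟩ = ⌊b⌉! γ_b` (`coeff_mul_of_dual`). Every expansion along `p` is
this identity. For `α = (0)` only `λ_e` with `e < 0` can vanish, and these do not meet nonnegative
powers of `D` (`coeff_mul_mask`).

The residue formula uses a second dual family, `D f' f^{-1-b}`: for `k ≠ b`, `f^{k-b} · D f'/f` is a
multiple of the Euler derivative of `f^{k-b}`, which has no constant term (`coeff_mul_euler_mul`).

Integral and real powers enter only through `IsPowerFamily`. The substitution `x ↦ ∑ x_a P a` is
multiplicative and triangular with nonzero diagonal, hence injective. Its off-diagonal part raises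
exponents by at least a fixed `ε > 0`, so over an Archimedean group a fixed-point argument makes it
surjective; the preimage `h` of `D` is the inverse. The image `y` of `hᵃ` satisfies `D dy/dD = a y`,
so it is a multiple of `Dᵃ`, and the leading coefficients make it `Dᵃ` itself
(`subst_inverse_apply`). In the continuous case this is where the choice of branch enters. -/

noncomputable section

set_option linter.unusedSectionVars false

namespace RomanLog

/-! ### Substitution into the powers of a delta operator. -/

section Substitution

variable {Γ K : Type*} [CommRing Γ] [LinearOrder Γ] [IsStrictOrderedRing Γ]
  [Field K] [Algebra Γ K]

theorem coeff_mul_lowest {x y : Op Γ K} {a b : Γ} (hx : ∀ i < a, x.coeff i = 0)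
    (hy : ∀ j < b, y.coeff j = 0) : (x * y).coeff (a + b) = x.coeff a * y.coeff b := by
  rw [HahnSeries.coeff_mul]
  rw [Finset.sum_eq_single (a, b)]
  · rintro ⟨i, j⟩ hij hne
    obtain ⟨hi, hj, hs⟩ := Finset.mem_antidiagonal.1 hij
    have hai : a ≤ i := not_lt.1 fun h => hi (hx i h)
    have hbj : b ≤ j := not_lt.1 fun h => hj (hy j h)
    refine absurd (Prod.ext ?_ ?_) hne
    · exact le_antisymm (le_of_add_le_add_right (hs.le.trans (by gcongr))) hai
    · exact le_antisymm (le_of_add_le_add_left (hs.le.trans (by gcongr))) hbj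
  · intro h
    rw [Finset.mem_antidiagonal] at h
    by_contra hne
    exact h ⟨left_ne_zero_of_mul hne, right_ne_zero_of_mul hne, rfl⟩

theorem smul_mul (r : K) (x y : Op Γ K) : r • x * y = r • (x * y) := by
  rw [← HahnSeries.single_zero_mul_eq_smul, ← HahnSeries.single_zero_mul_eq_smul, mul_assoc]

theorem mul_smul' (r : K) (x y : Op Γ K) : x * r • y = r • (x * y) := by
  rw [mul_comm, smul_mul, mul_comm]

/-- The family of the terms of a series. -/
def monomials (x : Op Γ K) : HahnSeries.SummableFamily Γ K Γ where
  toFun a := HahnSeries.single a (x.coeff a)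
  isPWO_iUnion_support' := x.isPWO_support.mono <| Set.iUnion_subset fun a b hb => by
    have hab := HahnSeries.support_single_subset hb
    rw [Set.mem_singleton_iff] at hab
    subst hab
    simpa using hb
  finite_co_support' b := (Set.finite_singleton b).subset fun a ha => by
    by_contra hab
    exact ha (HahnSeries.coeff_single_of_ne (Ne.symm hab))

@[simp]
theorem monomials_apply (x : Op Γ K) (a : Γ) :
    monomials x a = HahnSeries.single a (x.coeff a) := rfl

theorem hsum_monomials (x : Op Γ K) : (monomials x).hsum = x := by
  ext b
  rw [HahnSeries.SummableFamily.coeff_hsum, finsum_eq_single _ b fun a ha => by simp [ha.symm]]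
  simp

/-- Reduces each convergent expansion in powers of `D` to an identity of coefficients. -/
theorem hasHSum_monomials {F : Op Γ K} {c : Γ → K} (h : ∀ b, c b = F.coeff b) :
    HasHSum (fun b => HahnSeries.single b (c b)) F :=
  ⟨monomials F, fun b => by simp [h], hsum_monomials F⟩

/-- The Euler operator `D d/dD`. -/
def euler (x : Op Γ K) : Op Γ K where
  coeff b := algebraMap Γ K b * x.coeff b
  isPWO_support' := x.isPWO_support.mono fun _ hb => right_ne_zero_of_mul hb

@[simp]
theorem coeff_euler (x : Op Γ K) (b : Γ) :
    (euler x).coeff b = algebraMap Γ K b * x.coeff b := rfl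

theorem support_euler_subset (x : Op Γ K) : (euler x).support ⊆ x.support :=
  fun _ hb => right_ne_zero_of_mul hb

theorem euler_mul (x y : Op Γ K) : euler (x * y) = euler x * y + x * euler y := by
  ext b
  rw [HahnSeries.coeff_add, coeff_euler,
    HahnSeries.coeff_mul_left' x.isPWO_support (support_euler_subset x),
    HahnSeries.coeff_mul_right' y.isPWO_support (support_euler_subset y), HahnSeries.coeff_mul,
    Finset.mul_sum, ← Finset.sum_add_distrib]
  refine Finset.sum_congr rfl fun ij hij => ?_
  rw [← (Finset.mem_antidiagonal.1 hij).2.2, map_add]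
  simp only [coeff_euler]
  ring

theorem pincherle_eq (x : Op Γ K) : pincherle x = HahnSeries.single (-1) 1 * euler x := by
  ext b
  rw [HahnSeries.coeff_single_mul]
  simp [pincherle]

/-- Real or integral powers of a series of degree one: a one-parameter group `P` of series such
that the support of `P a` lies in a translate by `a` of a fixed set, and whose logarithmic
derivatives are proportional. -/
structure IsPowerFamily (P : Γ → Op Γ K) : Prop where
  zero : P 0 = 1
  add : ∀ a b, P (a + b) = P a * P b
  supp : ∃ S : Set Γ, S.IsPWO ∧ (∀ s ∈ S, 0 ≤ s) ∧ ∀ a b, (P a).coeff b ≠ 0 → b - a ∈ S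
  euler_eq : ∀ a, euler (P a) = algebraMap Γ K a • (P a * (P (-1) * euler (P 1)))

namespace IsPowerFamily

variable {P : Γ → Op Γ K} (hP : IsPowerFamily P)
include hP

theorem coeff_of_lt {a b : Γ} (h : b < a) : (P a).coeff b = 0 := by
  obtain ⟨S, -, h0, hS⟩ := hP.supp
  by_contra hb
  exact absurd (h0 _ (hS a b hb)) (not_le.2 (sub_neg.2 h))

theorem lead_add (a b : Γ) :
    (P (a + b)).coeff (a + b) = (P a).coeff a * (P b).coeff b := by
  rw [hP.add, coeff_mul_lowest (fun _ => hP.coeff_of_lt) (fun _ => hP.coeff_of_lt)]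

theorem lead_ne_zero (a : Γ) : (P a).coeff a ≠ 0 := by
  have h := hP.lead_add (-a) a
  rw [neg_add_cancel, hP.zero] at h
  intro h0
  simp [h0] at h

/-- A contribution to `D^b` splits `b` as `a + (b - a)` with the summands in two fixed well-ordered
sets, which is possible in finitely many ways. -/
theorem finite_contributions (x : Op Γ K) (b : Γ) :
    {a | x.coeff a ≠ 0 ∧ (P a).coeff b ≠ 0}.Finite := by
  obtain ⟨S, hS, -, hPS⟩ := hP.supp
  refine ((Finset.antidiagonal x.isPWO_support hS b).image Prod.fst).finite_toSet.subset ?_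
  rintro a ⟨ha, hb⟩
  rw [Finset.mem_coe, Finset.mem_image]
  exact ⟨(a, b - a), Finset.mem_antidiagonal.2 ⟨ha, hPS a b hb, by simp⟩, rfl⟩

/-- The family `x_a • P a`. -/
def family (x : Op Γ K) : HahnSeries.SummableFamily Γ K Γ where
  toFun a := x.coeff a • P a
  isPWO_iUnion_support' := by
    obtain ⟨S, hS, -, hPS⟩ := hP.supp
    refine (x.isPWO_support.add hS).mono (Set.iUnion_subset fun a b hb => ?_)
    have hb : x.coeff a * (P a).coeff b ≠ 0 := hb
    exact ⟨a, left_ne_zero_of_mul hb, b - a, hPS a b (right_ne_zero_of_mul hb), by simp⟩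
  finite_co_support' b := (hP.finite_contributions x b).subset fun a ha => by
    have ha : x.coeff a * (P a).coeff b ≠ 0 := ha
    exact ⟨left_ne_zero_of_mul ha, right_ne_zero_of_mul ha⟩

@[simp]
theorem family_apply (x : Op Γ K) (a : Γ) : hP.family x a = x.coeff a • P a := rfl

/-- The substitution `∑ x_a P a`. -/
def subst (x : Op Γ K) : Op Γ K := (hP.family x).hsum

theorem isComp_subst (x : Op Γ K) : IsComp x P (hP.subst x) :=
  ⟨hP.family x, fun _ => rfl, rfl⟩

theorem eq_subst_of_isComp {x F : Op Γ K} (h : IsComp x P F) : F = hP.subst x := by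
  obtain ⟨t, ht, rfl⟩ := h
  exact congrArg _ (HahnSeries.SummableFamily.ext ht)

theorem coeff_subst (x : Op Γ K) (b : Γ) :
    (hP.subst x).coeff b = ∑ᶠ a, x.coeff a * (P a).coeff b := rfl

theorem subst_sub (x y : Op Γ K) : hP.subst (x - y) = hP.subst x - hP.subst y := by
  rw [subst, subst, subst, ← HahnSeries.SummableFamily.hsum_sub]
  refine congrArg _ (HahnSeries.SummableFamily.ext fun a => ?_)
  simp [sub_smul]

theorem subst_smul (r : K) (x : Op Γ K) : hP.subst (r • x) = r • hP.subst x := by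
  ext b
  rw [HahnSeries.coeff_smul, coeff_subst, coeff_subst, smul_eq_mul, ← smul_eq_mul,
    smul_finsum' r (((hP.finite_contributions x b)).subset fun a ha =>
      ⟨left_ne_zero_of_mul ha, right_ne_zero_of_mul ha⟩)]
  simp [mul_assoc]

theorem subst_single (a : Γ) (r : K) : hP.subst (HahnSeries.single a r) = r • P a := by
  ext b
  rw [coeff_subst, finsum_eq_single _ a fun c hc => by
    rw [HahnSeries.coeff_single_of_ne hc, zero_mul]]
  simp

/-- Pairing a substituted series with another series is computed termwise. -/
theorem coeff_subst_mul (x y : Op Γ K) (b : Γ) :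
    (hP.subst x * y).coeff b = ∑ᶠ a, x.coeff a * (P a * y).coeff b := by
  rw [mul_comm, subst, ← HahnSeries.SummableFamily.hsum_smul,
    HahnSeries.SummableFamily.coeff_hsum]
  refine finsum_congr fun a => ?_
  rw [HahnSeries.SummableFamily.smul_apply, HahnSeries.of_symm_smul_of_eq_mul]
  rw [family_apply, mul_comm y, smul_mul, HahnSeries.coeff_smul, smul_eq_mul]

/-- Substitution commutes with infinite sums. -/
theorem coeff_subst_hsum {ι : Type*} (s : HahnSeries.SummableFamily Γ K ι) (b : Γ) :
    (hP.subst s.hsum).coeff b = ∑ᶠ i, (hP.subst (s i)).coeff b := by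
  obtain ⟨S, hS, -, hPS⟩ := hP.supp
  classical
  -- One finite set of exponents serves all `i` at once, so the two sums can be exchanged.
  set A : Finset Γ := (Finset.antidiagonal s.isPWO_iUnion_support hS b).image Prod.fst with hA
  have hmem : ∀ i a, (s i).coeff a * (P a).coeff b ≠ 0 → a ∈ A := by
    intro i a h
    refine Finset.mem_image.2 ⟨(a, b - a), Finset.mem_antidiagonal.2 ⟨?_, ?_, by simp⟩, rfl⟩
    · exact Set.mem_iUnion.2 ⟨i, left_ne_zero_of_mul h⟩
    · exact hPS a b (right_ne_zero_of_mul h)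
  have hsub : ∀ i, (hP.subst (s i)).coeff b = ∑ a ∈ A, (s i).coeff a * (P a).coeff b :=
    fun i => finsum_eq_sum_of_support_subset _ fun a ha => hmem i a ha
  have hfin : ∀ a ∈ A, (Function.support fun i => (s i).coeff a * (P a).coeff b).Finite :=
    fun a _ => (s.finite_co_support a).subset fun i hi => left_ne_zero_of_mul hi
  have hmul : ∀ a, s.hsum.coeff a * (P a).coeff b = ∑ᶠ i, (s i).coeff a * (P a).coeff b :=
    fun a => finsum_mul' _ _ (s.finite_co_support a)
  rw [finsum_congr hsub, finsum_sum_comm _ _ hfin, coeff_subst,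
    finsum_eq_sum_of_support_subset (s := A)]
  · exact Finset.sum_congr rfl fun a _ => hmul a
  · intro a ha
    rw [Function.mem_support, hmul] at ha
    by_contra hA
    exact ha (finsum_eq_zero_of_forall_eq_zero fun i => not_not.1 fun hi => hA (hmem i a hi))

theorem subst_single_mul (a : Γ) (r : K) (y : Op Γ K) :
    hP.subst (HahnSeries.single a r * y) = r • P a * hP.subst y := by
  ext b
  rw [mul_comm (r • P a), coeff_subst_mul, coeff_subst,
    ← finsum_comp_equiv (Equiv.addRight a)]
  refine finsum_congr fun c => ?_
  rw [Equiv.coe_addRight, HahnSeries.coeff_single_mul, add_sub_cancel_right, hP.add,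
    mul_smul', HahnSeries.coeff_smul, smul_eq_mul]
  ring

/-- Cut `x * y` into the terms `x_a Dᵃ y`; on each of these the group law of `P` gives
multiplicativity. -/
theorem subst_mul (x y : Op Γ K) : hP.subst (x * y) = hP.subst x * hP.subst y := by
  have hxy : x * y = (y • monomials x).hsum := by
    rw [HahnSeries.SummableFamily.hsum_smul, hsum_monomials, mul_comm]
  ext b
  rw [hxy, coeff_subst_hsum, coeff_subst_mul]
  refine finsum_congr fun a => ?_
  rw [HahnSeries.SummableFamily.smul_apply, HahnSeries.of_symm_smul_of_eq_mul, monomials_apply,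
    mul_comm, subst_single_mul, smul_mul, HahnSeries.coeff_smul, smul_eq_mul]

/-- The chain rule. -/
theorem euler_subst (x : Op Γ K) :
    euler (hP.subst x) = hP.subst (euler x) * (P (-1) * euler (P 1)) := by
  ext b
  rw [coeff_subst_mul, coeff_euler, coeff_subst, ← smul_eq_mul,
    smul_finsum' _ (((hP.finite_contributions x b)).subset fun a ha =>
      ⟨left_ne_zero_of_mul ha, right_ne_zero_of_mul ha⟩)]
  refine finsum_congr fun a => ?_
  have h := congrArg (fun z => z.coeff b) (hP.euler_eq a)
  simp only [coeff_euler, HahnSeries.coeff_smul, smul_eq_mul] at h ⊢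
  rw [mul_left_comm, h]
  ring

/-- Since `P a` starts at `Dᵃ`, substitution is triangular and only the diagonal term reaches the
lowest exponent. -/
theorem coeff_subst_lowest {x : Op Γ K} {o : Γ} (hx : ∀ a < o, x.coeff a = 0) :
    (∀ b < o, (hP.subst x).coeff b = 0) ∧ (hP.subst x).coeff o = x.coeff o * (P o).coeff o := by
  have h : ∀ a b, b ≤ o → a ≠ b → x.coeff a * (P a).coeff b = 0 := by
    intro a b hb hab
    rcases lt_or_ge a o with ha | ha
    · rw [hx a ha, zero_mul]
    · rw [hP.coeff_of_lt (lt_of_le_of_ne (hb.trans ha) hab.symm), mul_zero]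
  constructor
  · intro b hb
    rw [coeff_subst, finsum_eq_single _ b fun a ha => h a b hb.le ha, hx b hb, zero_mul]
  · rw [coeff_subst, finsum_eq_single _ o fun a ha => h a o le_rfl ha]

theorem subst_injective : Function.Injective hP.subst := by
  intro x y hxy
  by_contra hne
  have hz : hP.subst (x - y) = 0 := by rw [hP.subst_sub, hxy, sub_self]
  have h := (hP.coeff_subst_lowest (x := x - y) (o := (x - y).order)
    fun a => HahnSeries.coeff_eq_zero_of_lt_order).2
  rw [hz, HahnSeries.coeff_zero, eq_comm, mul_eq_zero, HahnSeries.coeff_order_eq_zero,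
    sub_eq_zero] at h
  exact h.elim hne (hP.lead_ne_zero _)

end IsPowerFamily

/-- A sequence in `S` either returns to or above its first term, or stays strictly below it from
then on. -/
theorem isPWO_of_isPWO_inter_Iio {S : Set Γ} (h : ∀ b, (S ∩ Set.Iio b).IsPWO) : S.IsPWO := by
  refine Set.partiallyWellOrderedOn_iff_exists_lt.2 fun u hu => ?_
  by_cases hlt : ∃ n, 0 < n ∧ u 0 ≤ u n
  · obtain ⟨n, hn, hle⟩ := hlt
    exact ⟨0, n, hn, hle⟩
  · push Not at hlt
    obtain ⟨i, j, hij, hle⟩ := (h (u 0)).exists_lt (f := fun n => u (n + 1))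
      fun n => ⟨hu _, hlt _ n.succ_pos⟩
    exact ⟨i + 1, j + 1, by omega, hle⟩

/-- A map which improves agreement of initial segments by a fixed amount has a fixed point. -/
theorem exists_fixedPoint [Archimedean Γ] (Φ : Op Γ K → Op Γ K) {ε : Γ} (hε : 0 < ε)
    (hΦ : ∀ t x y, (∀ a < t, x.coeff a = y.coeff a) →
      ∀ a < t + ε, (Φ x).coeff a = (Φ y).coeff a) : ∃ x, Φ x = x := by
  set o := min 0 (Φ 0).order with ho
  have hstep : ∀ k : ℕ, ∀ a < o + k • ε, (Φ^[k] 0).coeff a = (Φ^[k + 1] 0).coeff a := by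
    intro k
    induction k with
    | zero =>
      intro a ha
      rw [zero_smul, add_zero] at ha
      simp [HahnSeries.coeff_eq_zero_of_lt_order (ha.trans_le (min_le_right _ _))]
    | succ k ih =>
      rw [succ_nsmul, ← add_assoc, Function.iterate_succ_apply', Function.iterate_succ_apply']
      exact hΦ _ _ _ ih
  have hmono : ∀ k l : ℕ, k ≤ l → ∀ a < o + k • ε, (Φ^[l] 0).coeff a = (Φ^[k] 0).coeff a := by
    intro k l hkl
    induction l, hkl using Nat.le_induction with
    | base => exact fun _ _ => rfl
    | succ l hkl ih =>
      intro a ha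
      rw [← hstep l a (ha.trans_le (by gcongr)), ih a ha]
  have harch : ∀ b : Γ, ∃ k : ℕ, b < o + k • ε := fun b => by
    obtain ⟨k, hk⟩ := Archimedean.arch (b - o) hε
    exact ⟨k + 1, by rw [succ_nsmul]; linarith⟩
  choose N hN using harch
  have hlim : ∀ k b, b < o + k • ε → (Φ^[N b] 0).coeff b = (Φ^[k] 0).coeff b := by
    intro k b hb
    rcases le_total k (N b) with h | h
    · exact hmono _ _ h _ hb
    · exact (hmono _ _ h _ (hN b)).symm
  -- Below `o + k • ε` all iterates from the `k`-th on agree, so the limit coincides there with one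
  -- iterate; in particular its support is locally well ordered.
  let x : Op Γ K :=
    { coeff := fun b => (Φ^[N b] 0).coeff b
      isPWO_support' := isPWO_of_isPWO_inter_Iio fun b =>
        (Φ^[N b] 0).isPWO_support.mono fun a ha => by
          have h := ha.1
          rwa [Function.mem_support, hlim (N b) a (lt_trans ha.2 (hN b))] at h }
  refine ⟨x, ?_⟩
  ext b
  have h := hΦ (o + N b • ε) x (Φ^[N b] 0) (fun a ha => hlim _ _ ha) b
    ((hN b).trans (lt_add_of_pos_right _ hε))
  rw [h, ← Function.iterate_succ_apply' Φ, ← hstep _ _ (hN b)]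

namespace IsPowerFamily

variable {P : Γ → Op Γ K} (hP : IsPowerFamily P)
include hP

/-- The gap is the least nonzero element of `S`; if there is none, any positive number serves. -/
theorem exists_gap : ∃ ε : Γ, 0 < ε ∧ ∀ a b, (P a).coeff b ≠ 0 → a ≠ b → a + ε ≤ b := by
  obtain ⟨S, hS, h0, hPS⟩ := hP.supp
  by_cases hne : (S \ {0}).Nonempty
  · have hwf : (S \ {0}).IsWF := (hS.mono Set.sdiff_subset).isWF
    have hmem := hwf.min_mem hne
    refine ⟨hwf.min hne, lt_of_le_of_ne (h0 _ hmem.1) (Ne.symm hmem.2), fun a b hb hab => ?_⟩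
    have := hwf.min_le hne ⟨hPS a b hb, sub_ne_zero.2 hab.symm⟩
    linarith
  · refine ⟨1, one_pos, fun a b hb hab => absurd ?_ hne⟩
    exact ⟨b - a, hPS a b hb, sub_ne_zero.2 hab.symm⟩

/-- With `Δ` dividing by the diagonal, `x - subst (Δ x)` is minus the off-diagonal part. Its
coefficient at `b` involves only `x_a` with `a + ε ≤ b`, so `x ↦ y + (x - subst (Δ x))` improves
agreement by `ε`, and a fixed point satisfies `subst (Δ x) = y`. -/
theorem subst_surjective [Archimedean Γ] : Function.Surjective hP.subst := by
  intro y
  obtain ⟨ε, hε, hgap⟩ := hP.exists_gap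
  let Δ : Op Γ K → Op Γ K := fun x =>
    { coeff := fun a => x.coeff a / (P a).coeff a
      isPWO_support' := x.isPWO_support.mono fun a ha => (div_ne_zero_iff.1 ha).1 }
  have hΔ : ∀ x a, (Δ x).coeff a = x.coeff a / (P a).coeff a := fun _ _ => rfl
  have hoff : ∀ x b, (x - hP.subst (Δ x)).coeff b =
      - ∑ᶠ a, (if a = b then 0 else (Δ x).coeff a * (P a).coeff b) := by
    intro x b
    have hb : (Δ x).coeff b * (P b).coeff b = x.coeff b := by
      rw [hΔ, div_mul_cancel₀ _ (hP.lead_ne_zero b)]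
    have hsum : (hP.subst (Δ x)).coeff b =
        (∑ᶠ a, if a = b then (Δ x).coeff a * (P a).coeff b else 0) +
          ∑ᶠ a, if a = b then 0 else (Δ x).coeff a * (P a).coeff b := by
      rw [← finsum_add_distrib, coeff_subst]
      · exact finsum_congr fun a => by split_ifs <;> simp
      · exact (Set.finite_singleton b).subset fun a ha => by
          by_contra hab
          exact ha (if_neg hab)
      · refine (hP.finite_contributions (Δ x) b).subset fun a ha => ?_
        have ha : (Δ x).coeff a * (P a).coeff b ≠ 0 := by
          intro h0
          simp [h0] at ha
        exact ⟨left_ne_zero_of_mul ha, right_ne_zero_of_mul ha⟩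
    rw [HahnSeries.coeff_sub, hsum, finsum_eq_single _ b fun a ha => if_neg ha, if_pos rfl, hb]
    ring
  obtain ⟨x, hx⟩ := exists_fixedPoint (fun x => y + (x - hP.subst (Δ x))) hε (by
    intro t x x' hxx' b hb
    rw [HahnSeries.coeff_add, HahnSeries.coeff_add, hoff, hoff]
    congr 2
    refine finsum_congr fun a => ?_
    split_ifs with hab
    · rfl
    · by_cases hz : (P a).coeff b = 0
      · rw [hz, mul_zero, mul_zero]
      · rw [hΔ, hΔ, hxx' a (by linarith [hgap a b hz hab])])
  refine ⟨Δ x, ?_⟩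
  rwa [← add_sub_assoc, sub_eq_iff_eq_add, add_comm y x, add_right_inj, eq_comm] at hx

end IsPowerFamily
end Substitution

/-! ### Inverse series and Lagrange inversion. -/

section Inverse

variable {Γ K : Type*} [CommRing Γ] [LinearOrder Γ] [IsStrictOrderedRing Γ]
  [Field K] [Algebra Γ K]

theorem euler_single (a : Γ) (r : K) :
    euler (HahnSeries.single a r : Op Γ K) = algebraMap Γ K a • HahnSeries.single a r := by
  ext b
  rw [coeff_euler, HahnSeries.coeff_smul, smul_eq_mul]
  by_cases h : b = a
  · rw [h]
  · rw [HahnSeries.coeff_single_of_ne h, mul_zero, mul_zero]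

theorem euler_one : euler (1 : Op Γ K) = 0 := by
  rw [← HahnSeries.single_zero_one, euler_single, map_zero, zero_smul]

theorem euler_D : euler (D : Op Γ K) = D := by
  rw [D, euler_single, map_one, one_smul]

theorem D_ne_zero : (D : Op Γ K) ≠ 0 := by
  simp [D]

theorem IsDelta.coeff_one_ne_zero {f : Op Γ K} (hf : IsDelta f) : f.coeff 1 ≠ 0 := by
  rw [← hf.2, ne_eq, HahnSeries.coeff_order_eq_zero]
  exact hf.1

theorem IsDelta.leadingCoeff_eq {f : Op Γ K} (hf : IsDelta f) : f.leadingCoeff = f.coeff 1 := by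
  rw [HahnSeries.leadingCoeff_eq, hf.2]

namespace IsPowerFamily

variable {P : Γ → Op Γ K} (hP : IsPowerFamily P)
include hP

theorem subst_D : hP.subst D = P 1 := by
  rw [D, subst_single, one_smul]

/-- The inverse series of `P 1` is again a delta operator. -/
theorem isDelta_of_subst_eq_D {h : Op Γ K} (hh : hP.subst h = D) :
    IsDelta h ∧ h.coeff 1 * (P 1).coeff 1 = 1 := by
  have hne : h ≠ 0 := by
    rintro rfl
    have h0 := hP.subst_sub 0 0
    rw [sub_self, sub_self, hh] at h0
    exact D_ne_zero h0
  obtain ⟨h1, h2⟩ := hP.coeff_subst_lowest (x := h) (o := h.order)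
    fun a => HahnSeries.coeff_eq_zero_of_lt_order
  have h3 : h.coeff h.order * (P h.order).coeff h.order ≠ 0 :=
    mul_ne_zero (mt HahnSeries.coeff_order_eq_zero.1 hne) (hP.lead_ne_zero _)
  rw [hh] at h1 h2
  have ho : h.order = 1 := by
    by_contra hne
    rw [← h2, D, HahnSeries.coeff_single_of_ne hne] at h3
    exact h3 rfl
  refine ⟨⟨hne, ho⟩, ?_⟩
  rw [ho] at h2
  rw [← h2, D, HahnSeries.coeff_single_same]

/-- If `R 1` is the inverse series of `P 1`, then `R a` is sent to `Dᵃ` by substitution. -/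
theorem subst_inverse_apply {R : Γ → Op Γ K} (hR : IsPowerFamily R)
    (hinj : Function.Injective (algebraMap Γ K))
    (h : hP.subst (R 1) = D) (hlead : ∀ a, (R a).coeff a * (P a).coeff a = 1) (a : Γ) :
    hP.subst (R a) = HahnSeries.single a 1 := by
  -- The image of each `R b` has logarithmic derivative `b • w`, with `w` independent of `b`. At `b
  -- = 1` the image is `D`, which forces `w = 1`.
  have key : ∀ b, euler (hP.subst (R b)) = algebraMap Γ K b • (hP.subst (R b) *
      (hP.subst (R (-1) * euler (R 1)) * (P (-1) * euler (P 1)))) := by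
    intro b
    rw [hP.euler_subst, hR.euler_eq, hP.subst_smul, hP.subst_mul, smul_mul, mul_assoc]
  have hone : hP.subst (R (-1) * euler (R 1)) * (P (-1) * euler (P 1)) = 1 := by
    have h1 := key 1
    rw [h, euler_D, map_one, one_smul] at h1
    exact mul_left_cancel₀ D_ne_zero (h1.symm.trans (mul_one D).symm)
  have ha := key a
  rw [hone, mul_one] at ha
  ext b
  by_cases hb : b = a
  · rw [hb, HahnSeries.coeff_single_same,
      (hP.coeff_subst_lowest fun c => hR.coeff_of_lt).2, hlead]
  · rw [HahnSeries.coeff_single_of_ne hb]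
    have hab := congrArg (fun z => z.coeff b) ha
    simp only [coeff_euler, HahnSeries.coeff_smul, smul_eq_mul] at hab
    -- The equation now reads `(b - a) y_b = 0`, so only the exponent `a` survives.
    rw [← sub_eq_zero, ← sub_mul, ← map_sub, mul_eq_zero, map_eq_zero_iff _ hinj,
      sub_eq_zero] at hab
    exact hab.resolve_left hb

theorem subst_subst {R : Γ → Op Γ K} (hR : IsPowerFamily R)
    (h : ∀ a, hP.subst (R a) = HahnSeries.single a 1) (x : Op Γ K) :
    hP.subst (hR.subst x) = x := by
  ext b
  rw [subst.eq_def hR, coeff_subst_hsum, finsum_eq_single _ b]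
  · rw [family_apply, subst_smul, h, HahnSeries.coeff_smul, HahnSeries.coeff_single_same,
      smul_eq_mul, mul_one]
  · intro a ha
    rw [family_apply, subst_smul, h, HahnSeries.coeff_smul,
      HahnSeries.coeff_single_of_ne ha.symm, smul_zero]

theorem subst_subst' {R : Γ → Op Γ K} (hR : IsPowerFamily R)
    (h : ∀ a, hP.subst (R a) = HahnSeries.single a 1) (x : Op Γ K) :
    hR.subst (hP.subst x) = x :=
  hP.subst_injective (hP.subst_subst hR h _)

/-- A series dual to the powers `P k` picks out a coefficient of the inverse substitution. -/
theorem coeff_subst_mul_dual {E : Op Γ K} {b : Γ}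
    (hE : ∀ k, (P k * E).coeff 0 = if k = b then 1 else 0) (x : Op Γ K) :
    (hP.subst x * E).coeff 0 = x.coeff b := by
  rw [coeff_subst_mul, finsum_eq_single _ b fun k hk => by rw [hE, if_neg hk, mul_zero], hE,
    if_pos rfl, mul_one]

/-- The constant term of `D f'/f` is the degree of `f`, here one. -/
theorem coeff_zero_logDeriv : (P (-1) * euler (P 1)).coeff 0 = 1 := by
  have h : (P (-1) * euler (P 1)).coeff (-1 + 1) = _ :=
    coeff_mul_lowest (fun _ => hP.coeff_of_lt)
      (fun j hj => by rw [coeff_euler, hP.coeff_of_lt hj, mul_zero])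
  rw [neg_add_cancel, coeff_euler, map_one, one_mul] at h
  have h1 := hP.lead_add (-1) 1
  rw [neg_add_cancel, hP.zero, HahnSeries.coeff_one, if_pos rfl] at h1
  rw [h, h1]

/-- Lagrange inversion: the residues of `f^(k-1-b) f'`. -/
theorem coeff_mul_euler_mul (hinj : Function.Injective (algebraMap Γ K)) (k b : Γ) :
    (P k * (euler (P 1) * P (-1 - b))).coeff 0 = if k = b then 1 else 0 := by
  have h : P k * (euler (P 1) * P (-1 - b)) = P (k - b) * (P (-1) * euler (P 1)) := by
    rw [sub_eq_add_neg, sub_eq_add_neg, hP.add, hP.add]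
    ring
  rw [h]
  split_ifs with hkb
  · rw [hkb, sub_self, hP.zero, one_mul, hP.coeff_zero_logDeriv]
  -- The product times `k - b` is an Euler derivative, whose constant term is zero.
  · have h1 := congrArg (fun z => z.coeff 0) (hP.euler_eq (k - b))
    simp only [coeff_euler, map_zero, zero_mul, HahnSeries.coeff_smul, smul_eq_mul] at h1
    rw [eq_comm, mul_eq_zero, map_eq_zero_iff _ hinj, sub_eq_zero] at h1
    exact h1.resolve_left hkb

theorem residue_formula (hinj : Function.Injective (algebraMap Γ K)) (x : Op Γ K) (b : Γ) :
    (hP.subst x * pincherle (P 1) * P (-1 - b)).coeff (-1) = x.coeff b := by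
  have h : hP.subst x * pincherle (P 1) * P (-1 - b) =
      HahnSeries.single (-1) 1 * (hP.subst x * (euler (P 1) * P (-1 - b))) := by
    rw [pincherle_eq]
    ring
  rw [h, HahnSeries.coeff_single_mul, sub_self, one_mul]
  exact hP.coeff_subst_mul_dual (fun k => hP.coeff_mul_euler_mul hinj k b) x

end IsPowerFamily

end Inverse

/-! ### Integral powers form a power family. -/

section Integral

variable {K : Type*} [Field K]

theorem order_inv {f : Op ℤ K} (hf : f ≠ 0) : (f⁻¹).order = -f.order := by
  have h := HahnSeries.order_mul hf (inv_ne_zero hf)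
  rw [mul_inv_cancel₀ hf, HahnSeries.order_one] at h
  linarith

theorem order_zpow {f : Op ℤ K} (hf : f ≠ 0) (a : ℤ) : (f ^ a).order = a * f.order := by
  induction a using Int.induction_on with
  | zero => simp
  | succ n ih =>
    rw [zpow_add_one₀ hf, HahnSeries.order_mul (zpow_ne_zero _ hf) hf, ih]
    ring
  | pred n ih =>
    rw [zpow_sub_one₀ hf, HahnSeries.order_mul (zpow_ne_zero _ hf) (inv_ne_zero hf), ih,
      order_inv hf]
    ring

theorem euler_zpow {f : Op ℤ K} (hf : f ≠ 0) (a : ℤ) :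
    euler (f ^ a) = (a : K) • (f ^ a * (f⁻¹ * euler f)) := by
  induction a using Int.induction_on with
  | zero => rw [zpow_zero, euler_one, Int.cast_zero, zero_smul]
  | succ n ih =>
    rw [zpow_add_one₀ hf, euler_mul, ih, Int.cast_add, add_smul, Int.cast_one, one_smul, smul_mul]
    congr 1
    · congr 1; ring
    · rw [mul_assoc, mul_inv_cancel_left₀ hf]
  | pred n ih =>
    rw [show f ^ (-(n : ℤ)) = f ^ (-(n : ℤ) - 1) * f by rw [← zpow_add_one₀ hf]; simp,
      euler_mul] at ih
    rw [Int.cast_sub, sub_smul, Int.cast_one, one_smul]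
    refine mul_right_cancel₀ hf ?_
    rw [sub_mul, smul_mul]
    have h1 : f ^ (-(n : ℤ) - 1) * (f⁻¹ * euler f) * f = f ^ (-(n : ℤ) - 1) * euler f := by
      field_simp
    rw [h1, eq_sub_iff_add_eq, ih, mul_assoc, mul_inv_cancel_left₀ hf]

theorem isPowerFamily_zpow {f : Op ℤ K} (hf : IsDelta f) :
    IsPowerFamily (fun a : ℤ => f ^ a) where
  zero := zpow_zero f
  add := zpow_add₀ hf.1
  supp := by
    refine ⟨Set.Ici 0, (BddBelow.isWF bddBelow_Ici).isPWO, fun s hs => hs, fun a b hb => ?_⟩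
    have h := HahnSeries.order_le_of_coeff_ne_zero hb
    rw [order_zpow hf.1, hf.2, mul_one] at h
    exact sub_nonneg.2 h
  euler_eq a := by
    simpa using euler_zpow hf.1 a

end Integral

/-! ### Real powers with a chosen branch form a power family. -/

section Real

theorem finsum_nat_succ {M : Type*} [AddCommMonoid M] {v : ℕ → M} (h0 : v 0 = 0) :
    ∑ᶠ n, v (n + 1) = ∑ᶠ n, v n := by
  rw [← finsum_mem_range (f := v) Nat.succ_injective, finsum_mem_def, Set.indicator_eq_self.2]
  rintro (_ | n) hn
  · exact absurd h0 hn
  · exact ⟨n, rfl⟩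

theorem euler_pow {u : Op ℝ ℂ} (n : ℕ) :
    euler (u ^ (n + 1)) = ((n : ℂ) + 1) • (euler u * u ^ n) := by
  induction n with
  | zero => simp
  | succ n ih =>
    rw [pow_succ, euler_mul, ih, smul_mul, mul_assoc, ← pow_succ, mul_comm (u ^ (n + 1)),
      Nat.cast_add, Nat.cast_one, add_smul ((n : ℂ) + 1), one_smul]

theorem euler_heval {u : Op ℝ ℂ} (hu : 0 < u.orderTop) (φ : PowerSeries ℂ) :
    euler (PowerSeries.heval u φ) =
      PowerSeries.heval u (PowerSeries.derivative ℂ φ) * euler u := by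
  ext b
  rw [coeff_euler, PowerSeries.heval_apply, PowerSeries.heval_apply, mul_comm _ (euler u),
    ← HahnSeries.SummableFamily.hsum_smul, HahnSeries.SummableFamily.coeff_hsum,
    HahnSeries.SummableFamily.coeff_hsum, ← smul_eq_mul, smul_finsum' _
      (HahnSeries.SummableFamily.finite_co_support _ b), ← finsum_nat_succ]
  · refine finsum_congr fun n => ?_
    rw [HahnSeries.SummableFamily.smul_apply, HahnSeries.of_symm_smul_of_eq_mul,
      HahnSeries.SummableFamily.powerSeriesFamily_of_orderTop_pos hu,
      HahnSeries.SummableFamily.powerSeriesFamily_of_orderTop_pos hu, mul_smul',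
      PowerSeries.coeff_derivative]
    have h := congrArg (fun z => z.coeff b) (euler_pow (u := u) n)
    simp only [coeff_euler, HahnSeries.coeff_smul, smul_eq_mul] at h ⊢
    rw [mul_left_comm, h]
    ring
  · rw [HahnSeries.SummableFamily.powerSeriesFamily_of_orderTop_pos hu, pow_zero]
    have h := congrArg (fun z => z.coeff b) (euler_one (Γ := ℝ) (K := ℂ))
    simp only [coeff_euler, HahnSeries.coeff_zero] at h
    rw [HahnSeries.coeff_smul, smul_eq_mul, smul_eq_mul, mul_left_comm, h, mul_zero]

/-- Coefficientwise this is `(n + 1) * choose a (n + 1) = a * choose (a - 1) n`. -/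
theorem derivative_binomialSeries (a : ℂ) :
    PowerSeries.derivative ℂ (PowerSeries.binomialSeries ℂ a) =
      a • PowerSeries.binomialSeries ℂ (a - 1) := by
  ext n
  have h := Ring.choose_smul_choose a (Nat.succ_le_succ (Nat.zero_le n))
  rw [Nat.choose_one_right, Nat.cast_one, Ring.choose_one_right, nsmul_eq_mul] at h
  rw [PowerSeries.coeff_derivative, PowerSeries.binomialSeries_coeff, PowerSeries.coeff_smul,
    PowerSeries.binomialSeries_coeff]
  simp only [smul_eq_mul, mul_one]
  rw [mul_comm]
  simpa using h

/-- The monoid generated by the support of `u` bounds the supports of all `(1 + u)ᵃ` simultaneously,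
as `IsPowerFamily` requires. -/
theorem coeff_heval_mem_closure {u : Op ℝ ℂ} (hu : 0 < u.orderTop) (φ : PowerSeries ℂ) {b : ℝ}
    (hb : (PowerSeries.heval u φ).coeff b ≠ 0) : b ∈ AddSubmonoid.closure u.support := by
  rw [PowerSeries.heval_apply] at hb
  obtain ⟨n, hn⟩ := Set.mem_iUnion.1 (HahnSeries.SummableFamily.support_hsum_subset hb)
  rw [HahnSeries.SummableFamily.powerSeriesFamily_of_orderTop_pos hu] at hn
  exact HahnSeries.SummableFamily.support_pow_subset_closure u n (right_ne_zero_of_mul hn)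

theorem exp_leadLog {f : Op ℝ ℂ} (hf : f ≠ 0) (n : ℤ) :
    Complex.exp (leadLog f n) = f.leadingCoeff := by
  rw [leadLog, Complex.exp_add, Complex.exp_log (HahnSeries.leadingCoeff_ne_zero.2 hf),
    mul_comm (2 * _ * _), Complex.exp_int_mul_two_pi_mul_I, mul_one]

/-- The series `u` such that `f = c D (1 + u)`. -/
def tail (f : Op ℝ ℂ) : Op ℝ ℂ := HahnSeries.single (-f.order) (f.leadingCoeff)⁻¹ * f - 1

theorem orderTop_tail_pos {f : Op ℝ ℂ} (hf : f ≠ 0) : 0 < (tail f).orderTop := by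
  have h := HahnSeries.unit_aux f (inv_mul_cancel₀ (HahnSeries.leadingCoeff_ne_zero.2 hf))
    (-f.order) (neg_add_cancel _)
  rwa [← HahnSeries.orderTop_neg, neg_sub] at h

theorem rpow_eq {f : Op ℝ ℂ} (hf : IsDelta f) (n : ℤ) (a : ℝ) :
    rpow f n a = HahnSeries.single a (Complex.exp (a * leadLog f n)) *
      PowerSeries.heval (tail f) (PowerSeries.binomialSeries ℂ (a : ℂ)) := by
  rw [rpow, hf.2, mul_one, tail, hf.2]

theorem coeff_rpow_self {f : Op ℝ ℂ} (hf : IsDelta f) (n : ℤ) (a : ℝ) :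
    (rpow f n a).coeff a = Complex.exp (a * leadLog f n) := by
  rw [rpow_eq hf, HahnSeries.coeff_single_mul, sub_self, PowerSeries.coeff_heval_zero,
    PowerSeries.binomialSeries_constantCoeff, mul_one]

theorem rpow_add {f : Op ℝ ℂ} (hf : IsDelta f) (n : ℤ) (a b : ℝ) :
    rpow f n (a + b) = rpow f n a * rpow f n b := by
  rw [rpow_eq hf, rpow_eq hf, rpow_eq hf, Complex.ofReal_add, PowerSeries.binomialSeries_add,
    map_mul, add_mul, Complex.exp_add, ← HahnSeries.single_mul_single]
  ring

theorem rpow_zero {f : Op ℝ ℂ} (hf : IsDelta f) (n : ℤ) : rpow f n 0 = 1 := by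
  rw [rpow_eq hf, Complex.ofReal_zero, PowerSeries.binomialSeries_zero, map_one, zero_mul,
    Complex.exp_zero, HahnSeries.single_zero_one, mul_one]

theorem single_mul_one_add_tail {f : Op ℝ ℂ} (hf : IsDelta f) :
    HahnSeries.single 1 f.leadingCoeff * (1 + tail f) = f := by
  rw [tail, add_sub_cancel, ← mul_assoc, HahnSeries.single_mul_single, hf.2, add_neg_cancel,
    mul_inv_cancel₀ (HahnSeries.leadingCoeff_ne_zero.2 hf.1), HahnSeries.single_zero_one, one_mul]

theorem rpow_one {f : Op ℝ ℂ} (hf : IsDelta f) (n : ℤ) : rpow f n 1 = f := by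
  have h : PowerSeries.binomialSeries ℂ ((1 : ℝ) : ℂ) = 1 + PowerSeries.X := by
    simpa using PowerSeries.binomialSeries_nat (R := ℂ) (A := ℂ) 1
  rw [rpow_eq hf, h, map_add, map_one, PowerSeries.heval_X _ (orderTop_tail_pos hf.1),
    Complex.ofReal_one, one_mul, exp_leadLog hf.1, single_mul_one_add_tail hf]

theorem isPowerFamily_rpow {f : Op ℝ ℂ} (hf : IsDelta f) (n : ℤ) :
    IsPowerFamily (rpow f n) where
  zero := rpow_zero hf n
  add := rpow_add hf n
  supp := by
    have h0 : ∀ s ∈ (tail f).support, 0 ≤ s := fun s hs => by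
      have h := (orderTop_tail_pos hf.1).trans_le (HahnSeries.orderTop_le_of_coeff_ne_zero hs)
      exact (WithTop.coe_lt_coe.1 h).le
    refine ⟨AddSubmonoid.closure (tail f).support,
      (tail f).isPWO_support.addSubmonoid_closure h0, fun s hs => ?_, fun a b hb => ?_⟩
    · exact (AddSubmonoid.closure_le (S := AddSubmonoid.nonneg ℝ)).2 h0 hs
    · rw [rpow_eq hf, HahnSeries.coeff_single_mul] at hb
      exact coeff_heval_mem_closure (orderTop_tail_pos hf.1) _ (right_ne_zero_of_mul hb)
  euler_eq a := by
    set u := tail f with hu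
    have hu0 : 0 < u.orderTop := orderTop_tail_pos hf.1
    have hY : ∀ c : ℝ, euler (PowerSeries.heval u (PowerSeries.binomialSeries ℂ (c : ℂ))) =
        (c : ℂ) • (PowerSeries.heval u (PowerSeries.binomialSeries ℂ (c : ℂ)) *
          (PowerSeries.heval u (PowerSeries.binomialSeries ℂ ((-1 : ℝ) : ℂ)) * euler u)) := by
      intro c
      rw [euler_heval hu0, derivative_binomialSeries, map_smul, smul_mul, ← mul_assoc, ← map_mul,
        ← PowerSeries.binomialSeries_add]
      push_cast
      rfl
    -- The monomial factor contributes `c` and the binomial factor `c (1 + u)⁻¹ · D du/dD` to the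
    -- logarithmic derivative. Taking `c = 1` identifies the common factor with `P (-1) * euler (P
    -- 1)`.
    have hR : ∀ c : ℝ, euler (rpow f n c) = (c : ℂ) • (rpow f n c *
        (1 + PowerSeries.heval u (PowerSeries.binomialSeries ℂ ((-1 : ℝ) : ℂ)) * euler u)) := by
      intro c
      rw [rpow_eq hf, euler_mul, hY, euler_single, mul_smul', smul_mul, Complex.coe_algebraMap,
        ← smul_add]
      congr 1
      ring
    rw [hR a, hR 1, Complex.ofReal_one, one_smul, ← mul_assoc (rpow f n (-1)), ← rpow_add hf,
      neg_add_cancel, rpow_zero hf, one_mul]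
    rfl

end Real

/-! ### The derivation `x d/dx` on iterated logarithms. -/

section Derivation

variable (K : Type*) [Field K]

theorem xDeriv_single (γ : LogIndex) :
    xDeriv K (Finsupp.single γ 1) = ∑ j ∈ γ.support,
      Finsupp.single (γ - ∑ i ∈ Finset.range (j + 1), Finsupp.single i (1 : ℤ))
        ((γ j : ℤ) : K) := by
  rw [xDeriv, Finsupp.linearCombination_single, one_smul]

theorem sum_single_range_apply (j i : ℕ) :
    (∑ l ∈ Finset.range (j + 1), Finsupp.single l (1 : ℤ)) i = if i ≤ j then 1 else 0 := by
  simp [Finsupp.finsetSum_apply, Finsupp.single_apply]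

/-- The derivation lowers the exponent of the simple logarithm by one. -/
theorem xDeriv_apply_ne_zero {v : LogIndex →₀ K} {m : ℤ} (hv : ∀ γ, v γ ≠ 0 → γ 0 = m)
    {γ : LogIndex} (hγ : xDeriv K v γ ≠ 0) : γ 0 = m - 1 := by
  rw [xDeriv, Finsupp.linearCombination_apply, Finsupp.sum, Finsupp.finsetSum_apply] at hγ
  obtain ⟨β, hβ, h⟩ := Finset.exists_ne_zero_of_sum_ne_zero hγ
  rw [Finsupp.smul_apply, Finsupp.finsetSum_apply] at h
  obtain ⟨j, -, h⟩ := Finset.exists_ne_zero_of_sum_ne_zero (right_ne_zero_of_mul h)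
  have hγβ := (Finsupp.single_apply_ne_zero.1 h).1
  rw [hγβ, Finsupp.sub_apply, sum_single_range_apply, if_pos (Nat.zero_le j),
    hv β (Finsupp.mem_support_iff.1 hβ)]

theorem xDeriv_iterate_apply_ne_zero {α γ : LogIndex} {k : ℕ}
    (hγ : ((xDeriv K)^[k] (Finsupp.single α 1)) γ ≠ 0) : γ 0 = α 0 - k := by
  induction k generalizing γ with
  | zero =>
    rw [(Finsupp.single_apply_ne_zero.1 hγ).1, Nat.cast_zero, sub_zero]
  | succ k ih =>
    rw [Function.iterate_succ_apply'] at hγ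
    rw [xDeriv_apply_ne_zero K (fun _ => ih) hγ]
    push_cast
    ring

/-- Different `j` subtract different vectors `e₀ + ⋯ + e_j`, so the terms of `∂ ℓ^α` are distinct
monomials and cannot cancel. -/
theorem exists_xDeriv_single_ne_zero [CharZero K] {α : LogIndex} (hα : α ≠ 0) :
    ∃ γ, xDeriv K (Finsupp.single α 1) γ ≠ 0 := by
  obtain ⟨j, hj⟩ := Finsupp.ne_iff.1 hα
  refine ⟨α - ∑ i ∈ Finset.range (j + 1), Finsupp.single i (1 : ℤ), ?_⟩
  rw [xDeriv_single, Finsupp.finsetSum_apply, Finset.sum_eq_single j]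
  · rw [Finsupp.single_eq_same]
    exact Int.cast_ne_zero.2 hj
  · intro i _ hij
    refine Finsupp.single_eq_of_ne fun h => hij ?_
    have h1 := fun l => DFunLike.congr_fun (sub_right_injective h) l
    simp only [sum_single_range_apply] at h1
    have h2 := h1 i
    have h3 := h1 j
    grind
  · intro h
    exact absurd (Finsupp.mem_support_iff.2 hj) h

end Derivation

/-- The properties of the Roman factorial and of the Stirling numbers which make
`λ_a^α` nonzero, except for `α = 0` and `a` negative. -/
structure IsRegularScale (Γ K : Type*) [CommRing Γ] [LinearOrder Γ] [Field K] [Scale Γ K] :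
    Prop where
  rfac_ne_zero : ∀ a : Γ, rfac K a ≠ 0
  rfac_zero : rfac K (0 : Γ) = 1
  rfac_neg_one : rfac K (-1 : Γ) = 1
  stirling : ∀ a : Γ, (Scale.stirling a 0 : K) ≠ 0 ∨ (Scale.stirling a 1 : K) ≠ 0
  stirling_zero : ∀ a : Γ, 0 ≤ a → (Scale.stirling a 0 : K) ≠ 0

/-! ### Harmonic logarithms encoded as series. -/

section Logarithms

variable {Γ K : Type*} [CommRing Γ] [LinearOrder Γ] [IsStrictOrderedRing Γ]
  [Field K] [Algebra Γ K] [Scale Γ K]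

/-- Each `∂` lowers the exponent of `log x` by one, so a monomial determines the only `k` that can
produce it. -/
theorem harmLog_apply {α γ : LogIndex} {k : ℕ} (hγ : γ 0 = α 0 - k) (a : Γ) :
    (harmLog α a : LogExpr Γ K) a γ =
      rfac K a * (Scale.stirling a k * ((xDeriv K)^[k] (Finsupp.single α 1)) γ) := by
  rw [harmLog, if_pos rfl, finsum_eq_single _ k]
  intro l hl
  by_contra h
  have := xDeriv_iterate_apply_ne_zero K (right_ne_zero_of_mul h)
  exact hl (by exact_mod_cast sub_right_injective (this.symm.trans hγ))

theorem harmLog_of_ne {α γ : LogIndex} {a b : Γ} (h : b ≠ a) :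
    (harmLog α a : LogExpr Γ K) b γ = 0 := if_neg h

theorem expand_apply (α : LogIndex) (c : Γ → K) (a : Γ) (γ : LogIndex) :
    expand α c a γ = c a * harmLog α a a γ :=
  finsum_eq_single _ a fun b hb => by rw [harmLog_of_ne hb.symm, mul_zero]

theorem exists_harmLog_ne_zero {α : LogIndex} {a : Γ}
    (h : (harmLog α a : LogExpr Γ K) ≠ 0) : ∃ γ, (harmLog α a : LogExpr Γ K) a γ ≠ 0 := by
  by_contra! h0
  refine h (funext fun b => funext fun γ => ?_)
  by_cases hb : b = a
  · rw [hb, h0, Pi.zero_apply, Pi.zero_apply]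
  · exact harmLog_of_ne hb

theorem IsRegularScale.harmLog_ne_zero_of_nonneg (hΓ : IsRegularScale Γ K) (α : LogIndex) {a : Γ}
    (ha : 0 ≤ a) : (harmLog α a : LogExpr Γ K) ≠ 0 := by
  intro h
  have h1 := harmLog_apply (K := K) (α := α) (γ := α) (k := 0) (by simp) a
  rw [h, Function.iterate_zero_apply, Finsupp.single_eq_same, mul_one] at h1
  exact mul_ne_zero (hΓ.rfac_ne_zero a) (hΓ.stirling_zero a ha) h1.symm

/-- If `s(-a, 0) ≠ 0` the monomial `ℓ^α` survives; otherwise `s(-a, 1) ≠ 0`, and `∂ ℓ^α ≠ 0` because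
`α ≠ 0`. -/
theorem IsRegularScale.harmLog_ne_zero [CharZero K] (hΓ : IsRegularScale Γ K) {α : LogIndex}
    (hα : α ≠ 0) (a : Γ) : (harmLog α a : LogExpr Γ K) ≠ 0 := by
  intro h
  rcases hΓ.stirling a with hs | hs
  · have h1 := harmLog_apply (K := K) (α := α) (γ := α) (k := 0) (by simp) a
    rw [h, Function.iterate_zero_apply, Finsupp.single_eq_same, mul_one] at h1
    exact mul_ne_zero (hΓ.rfac_ne_zero a) hs h1.symm
  · obtain ⟨γ, hγ⟩ := exists_xDeriv_single_ne_zero K hα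
    have h0 : γ 0 = α 0 - (1 : ℕ) := xDeriv_iterate_apply_ne_zero K (k := 1) hγ
    have h1 := harmLog_apply (K := K) h0 a
    rw [h, Function.iterate_one] at h1
    exact mul_ne_zero (hΓ.rfac_ne_zero a) (mul_ne_zero hs hγ) h1.symm

open Classical in
-- Logarithms of different degrees involve different powers of `x`, so a coefficient can be read off
-- wherever `λ_b^α ≠ 0`. The chosen expansion therefore does not matter.
theorem coords_expand (α : LogIndex) {c : Γ → K} (hc : IsNoetherian c) (b : Γ) :
    coords α (expand α c) b = if (harmLog α b : LogExpr Γ K) = 0 then 0 else c b := by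
  have hex : ∃ c', IsExpansion α c' (expand α c) := by
    refine ⟨fun b => if (harmLog α b : LogExpr Γ K) = 0 then 0 else c b,
      hc.subset fun b hb => ?_, fun b hb => if_pos hb, ?_⟩
    · intro h
      exact hb (by simp [h])
    · funext a γ
      rw [expand_apply, expand_apply]
      split_ifs with h
      · rw [h, Pi.zero_apply, Pi.zero_apply, mul_zero, mul_zero]
      · rfl
  rw [coords, dif_pos hex]
  obtain ⟨-, h0, heq⟩ := hex.choose_spec
  split_ifs with h
  · exact h0 b h
  · obtain ⟨γ, hγ⟩ := exists_harmLog_ne_zero h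
    have h1 := congrFun (congrFun heq b) γ
    rw [expand_apply, expand_apply] at h1
    exact (mul_right_cancel₀ hγ h1).symm

/-- The element of `𝓘^α` encoded by a series `C`: the coefficient of `λ_e^α` is `C_{-e} / ⌊e⌉!`. In
this encoding operators act by multiplication. -/
def ofOp (α : LogIndex) (C : Op Γ K) : LogExpr Γ K :=
  expand α fun e => C.coeff (-e) / rfac K e

theorem isNoetherian_ofOp (C : Op Γ K) :
    IsNoetherian (fun e : Γ => C.coeff (-e) / rfac K e) := by
  have h : (Neg.neg '' (Neg.neg ⁻¹' C.support : Set Γ)).WellFoundedOn (· < ·) :=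
    C.isWF_support.mono (by rintro _ ⟨x, hx, rfl⟩; exact hx)
  rw [Set.wellFoundedOn_image] at h
  refine h.mono (fun a b hab => neg_lt_neg hab) fun e he => ?_
  exact (div_ne_zero_iff.1 he).1

theorem IsNoetherian.isPWO_neg {c : Γ → K} (hc : IsNoetherian c) :
    (Neg.neg ⁻¹' Function.support c : Set Γ).IsPWO := by
  have h : (Neg.neg '' (Neg.neg ⁻¹' Function.support c : Set Γ)).WellFoundedOn (· > ·) :=
    hc.subset (by rintro _ ⟨x, hx, rfl⟩; exact hx)
  rw [Set.wellFoundedOn_image] at h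
  exact Set.IsWF.isPWO (h.mono (fun a b hab => neg_lt_neg hab) subset_rfl)

/-- The same `C` works for every `α`, which is what lets one dual family represent a graded
sequence. -/
theorem exists_eq_ofOp (hΓ : IsRegularScale Γ K) {c : Γ → K} (hc : IsNoetherian c) :
    ∃ C : Op Γ K, (∀ b, C.coeff b = rfac K (-b) * c (-b)) ∧ ∀ α, expand α c = ofOp α C := by
  refine ⟨⟨fun b => rfac K (-b) * c (-b), ?_⟩, fun _ => rfl, fun α => ?_⟩
  · exact hc.isPWO_neg.mono fun b hb => right_ne_zero_of_mul hb
  · unfold ofOp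
    congr 1
    funext e
    simp only [neg_neg]
    rw [mul_div_cancel_left₀ _ (hΓ.rfac_ne_zero e)]

open Classical in
/-- The series `C` without the terms which do not contribute to `ofOp α C`. -/
def mask (α : LogIndex) (C : Op Γ K) : Op Γ K where
  coeff b := if (harmLog α (-b) : LogExpr Γ K) = 0 then 0 else C.coeff b
  isPWO_support' := C.isPWO_support.mono fun b hb h => hb (by simp [h])

theorem coords_ofOp (α : LogIndex) (C : Op Γ K) (e : Γ) :
    coords α (ofOp α C) e = (mask α C).coeff (-e) / rfac K e := by
  classical
  rw [ofOp, coords_expand α (isNoetherian_ofOp C)]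
  simp only [mask, neg_neg]
  split_ifs <;> simp

theorem aug_ofOp (hΓ : IsRegularScale Γ K) (α : LogIndex) (C : Op Γ K) :
    aug α (ofOp α C) = C.coeff 0 := by
  classical
  rw [aug, ofOp, coords_expand α (isNoetherian_ofOp C),
    if_neg (hΓ.harmLog_ne_zero_of_nonneg α le_rfl), neg_zero, hΓ.rfac_zero, div_one]

theorem coeff_mul_neg (x y : Op Γ K) (e : Γ) :
    (x * y).coeff (-e) = ∑ᶠ a, x.coeff a * y.coeff (-(e + a)) := by
  have h : x * y = (y • monomials x).hsum := by
    rw [HahnSeries.SummableFamily.hsum_smul, hsum_monomials, mul_comm]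
  rw [h, HahnSeries.SummableFamily.coeff_hsum]
  refine finsum_congr fun a => ?_
  rw [HahnSeries.SummableFamily.smul_apply, HahnSeries.of_symm_smul_of_eq_mul, monomials_apply,
    mul_comm, HahnSeries.coeff_single_mul, neg_add']

theorem act_ofOp (hΓ : IsRegularScale Γ K) (α : LogIndex) (g C : Op Γ K) :
    act α g (ofOp α C) = ofOp α (g * mask α C) := by
  rw [act, ofOp.eq_def α (g * _)]
  congr 1
  funext e
  rw [coeff_mul_neg, div_eq_inv_mul, ← smul_eq_mul, smul_finsum]
  refine finsum_congr fun a => ?_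
  have ha := hΓ.rfac_ne_zero (e + a)
  rw [coords_ofOp, smul_eq_mul]
  field_simp

theorem aug_act_ofOp (hΓ : IsRegularScale Γ K) (α : LogIndex) (g C : Op Γ K) :
    aug α (act α g (ofOp α C)) = (g * mask α C).coeff 0 := by
  rw [act_ofOp hΓ, aug_ofOp hΓ]

theorem mask_eq_self [CharZero K] (hΓ : IsRegularScale Γ K) {α : LogIndex} (hα : α ≠ 0)
    (C : Op Γ K) : mask α C = C := by
  ext b
  exact if_neg (hΓ.harmLog_ne_zero hα _)

/-- The constant term pairs `g_a` with the coordinate of `λ_a^α`. Only `a ≥ 0` occurs, and there the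
mask removes nothing, even for `α = 0`. -/
theorem coeff_mul_mask (hΓ : IsRegularScale Γ K) (α : LogIndex) {g : Op Γ K}
    (hg : ∀ a, g.coeff a ≠ 0 → 0 ≤ a) (C : Op Γ K) :
    (g * mask α C).coeff 0 = (g * C).coeff 0 := by
  have h := coeff_mul_neg g (mask α C) 0
  have h' := coeff_mul_neg g C 0
  rw [neg_zero] at h h'
  rw [h, h']
  refine finsum_congr fun a => ?_
  by_cases ha : g.coeff a = 0
  · rw [ha, zero_mul, zero_mul]
  · congr 1
    refine if_neg (hΓ.harmLog_ne_zero_of_nonneg α ?_)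
    simpa using hg a ha

theorem ofOp_injective [CharZero K] (hΓ : IsRegularScale Γ K) {α : LogIndex} (hα : α ≠ 0) :
    Function.Injective (ofOp α : Op Γ K → LogExpr Γ K) := by
  intro C C' h
  ext b
  have h1 := congrArg (fun p => coords α p (-b)) h
  simp only [coords_ofOp, mask_eq_self hΓ hα, neg_neg] at h1
  exact (div_left_inj' (hΓ.rfac_ne_zero _)).1 h1

theorem smul_ofOp (α : LogIndex) (r : K) (C : Op Γ K) : r • ofOp α C = ofOp α (r • C) := by
  funext a γ
  rw [Pi.smul_apply, Pi.smul_apply, ofOp, ofOp, expand_apply, expand_apply,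
    HahnSeries.coeff_smul, smul_eq_mul, smul_eq_mul]
  ring

theorem harmLog_eq_ofOp (hΓ : IsRegularScale Γ K) (α : LogIndex) (b : Γ) :
    (harmLog α b : LogExpr Γ K) = ofOp α (HahnSeries.single (-b) (rfac K b)) := by
  funext a γ
  rw [ofOp, expand_apply]
  by_cases h : a = b
  · rw [h, HahnSeries.coeff_single_same, div_self (hΓ.rfac_ne_zero b), one_mul]
  · rw [harmLog_of_ne h, HahnSeries.coeff_single_of_ne (neg_injective.ne h), zero_div, zero_mul]

end Logarithms

/-! ### Nonvanishing of Roman factorials and Stirling numbers. -/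

section Scales

theorem rfacInt_ne_zero (K : Type*) [Field K] [CharZero K] (a : ℤ) : rfacInt K a ≠ 0 := by
  rw [rfacInt]
  split_ifs
  · exact Nat.cast_ne_zero.2 (Nat.factorial_ne_zero _)
  · exact div_ne_zero (zpow_ne_zero _ (by simp)) (Nat.cast_ne_zero.2 (Nat.factorial_ne_zero _))

theorem coeff_zero_gammaQuotInt_ne_zero (K : Type*) [Field K] [CharZero K] {a : ℤ} (ha : 0 ≤ a) :
    PowerSeries.coeff 0 (gammaQuotInt K a) ≠ 0 := by
  rw [gammaQuotInt, Int.toNat_of_nonpos (neg_nonpos.2 ha), Finset.prod_range_zero, mul_one,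
    PowerSeries.coeff_zero_eq_constantCoeff_apply, PowerSeries.constantCoeff_inv, map_prod]
  refine inv_ne_zero (Finset.prod_ne_zero_iff.2 fun i _ => ?_)
  rw [map_add, PowerSeries.constantCoeff_X, PowerSeries.constantCoeff_C, zero_add]
  exact Nat.cast_add_one_ne_zero i

/-- For negative `a` the product contains the factor `X` exactly once, and the other factors have
nonzero constant terms. -/
theorem coeff_one_gammaQuotInt_ne_zero (K : Type*) [Field K] [CharZero K] {a : ℤ} (ha : a < 0) :
    PowerSeries.coeff 1 (gammaQuotInt K a) ≠ 0 := by
  obtain ⟨m, hm⟩ : ∃ m : ℕ, (-a).toNat = m + 1 := ⟨(-a).toNat - 1, by omega⟩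
  rw [gammaQuotInt, Int.toNat_of_nonpos ha.le, hm, Finset.prod_range_zero, Finset.prod_range_succ',
    Nat.cast_zero, map_zero, sub_zero, inv_one, one_mul, ← zero_add 1, PowerSeries.coeff_succ_mul_X,
    PowerSeries.coeff_zero_eq_constantCoeff_apply, map_prod]
  refine Finset.prod_ne_zero_iff.2 fun i _ => ?_
  rw [map_sub, PowerSeries.constantCoeff_X, PowerSeries.constantCoeff_C, zero_sub]
  exact neg_ne_zero.2 (Nat.cast_ne_zero.2 i.succ_ne_zero)

theorem isRegularScale_int (K : Type*) [Field K] [CharZero K] : IsRegularScale ℤ K where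
  rfac_ne_zero := rfacInt_ne_zero K
  rfac_zero := by
    change rfacInt K 0 = 1
    simp [rfacInt]
  rfac_neg_one := by
    change rfacInt K (-1) = 1
    simp [rfacInt]
  stirling a := (le_or_gt 0 a).imp (coeff_zero_gammaQuotInt_ne_zero K)
    (coeff_one_gammaQuotInt_ne_zero K)
  stirling_zero _ := coeff_zero_gammaQuotInt_ne_zero K

theorem natCast_ne_of_norm_lt_one {ε : ℂ} (h0 : ε ≠ 0) (h1 : ‖ε‖ < 1) (k : ℤ) : ε ≠ k := by
  rintro rfl
  rw [Complex.norm_intCast] at h1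
  have hk : |k| < 1 := by exact_mod_cast h1
  exact h0 (by rw [Int.abs_lt_one_iff.1 hk, Int.cast_zero])

theorem Gamma_one_add_eq_prod {ε : ℂ} (h0 : ε ≠ 0) (h1 : ‖ε‖ < 1) (m : ℕ) :
    Complex.Gamma (1 + ε) =
      (ε * ∏ i ∈ Finset.range m, (ε - ((i : ℂ) + 1))) * Complex.Gamma (ε - m) := by
  induction m with
  | zero =>
    rw [Finset.prod_range_zero, mul_one, Nat.cast_zero, sub_zero, add_comm,
      Complex.Gamma_add_one ε h0]
  | succ m ih =>
    have hne : ε - ((m : ℂ) + 1) ≠ 0 := by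
      have := natCast_ne_of_norm_lt_one h0 h1 (m + 1)
      push_cast at this
      exact sub_ne_zero.2 this
    have hG := Complex.Gamma_add_one _ hne
    rw [show ε - ((m : ℂ) + 1) + 1 = ε - m by ring] at hG
    rw [ih, hG, Finset.prod_range_succ, Nat.cast_add, Nat.cast_one]
    ring

theorem Gamma_div_Gamma_eq_prod {ε : ℂ} (h1 : ‖ε‖ < 1) (m : ℕ) :
    Complex.Gamma (1 + ε) / Complex.Gamma (1 + ε + (-((m : ℂ) + 1))) =
      ε * ∏ i ∈ Finset.range m, (ε - ((i : ℂ) + 1)) := by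
  rw [show 1 + ε + (-((m : ℂ) + 1)) = ε - m by ring]
  by_cases h0 : ε = 0
  -- At `ε = 0` the denominator sits at a pole, where `Complex.Gamma` has value zero; the quotient
  -- is then zero, in agreement with the product.
  · rw [h0, zero_sub, Complex.Gamma_neg_nat_eq_zero, div_zero, zero_mul]
  · rw [Gamma_one_add_eq_prod h0 h1 m, mul_div_cancel_right₀]
    refine Complex.Gamma_ne_zero fun k hk => natCast_ne_of_norm_lt_one h0 h1 (m - k) ?_
    push_cast
    linear_combination hk

theorem deriv_Gamma_div_Gamma_ne_zero (m : ℕ) :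
    deriv (fun ε : ℂ => Complex.Gamma (1 + ε) / Complex.Gamma (1 + ε + (-((m : ℂ) + 1)))) 0
      ≠ 0 := by
  have heq : (fun ε : ℂ => Complex.Gamma (1 + ε) / Complex.Gamma (1 + ε + (-((m : ℂ) + 1))))
      =ᶠ[nhds 0] fun ε => ε * ∏ i ∈ Finset.range m, (ε - ((i : ℂ) + 1)) := by
    filter_upwards [Metric.ball_mem_nhds (0 : ℂ) one_pos] with ε hε
    exact Gamma_div_Gamma_eq_prod (by simpa using hε) m
  have hd : DifferentiableAt ℂ (fun ε : ℂ => ∏ i ∈ Finset.range m, (ε - ((i : ℂ) + 1))) 0 := by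
    fun_prop
  rw [heq.deriv_eq, deriv_fun_mul differentiableAt_fun_id hd, deriv_id'', one_mul, zero_mul,
    add_zero]
  refine Finset.prod_ne_zero_iff.2 fun i _ => ?_
  rw [zero_sub]
  exact neg_ne_zero.2 (Nat.cast_add_one_ne_zero i)

/-- The value at `ε = 0` is `1 / Γ(1 + a)`, and `1 + a` is not a pole. -/
theorem stirling_real_zero_ne_zero {a : ℝ} (ha : ∀ m : ℕ, a ≠ -(m + 1)) :
    (Scale.stirling a 0 : ℂ) ≠ 0 := by
  change iteratedDeriv 0 (fun ε : ℂ => Complex.Gamma (1 + ε) / Complex.Gamma (1 + ε + a)) 0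
      / (Nat.factorial 0 : ℂ) ≠ 0
  rw [iteratedDeriv_zero, Nat.factorial_zero, Nat.cast_one, div_one, add_zero, Complex.Gamma_one]
  refine one_div_ne_zero (Complex.Gamma_ne_zero fun m hm => ha m ?_)
  have h : 1 + a = -m := by exact_mod_cast hm
  linarith

theorem stirling_real_one_ne_zero (m : ℕ) :
    (Scale.stirling (-(m + 1) : ℝ) 1 : ℂ) ≠ 0 := by
  change iteratedDeriv 1 (fun ε : ℂ => Complex.Gamma (1 + ε) /
    Complex.Gamma (1 + ε + ((-(m + 1) : ℝ) : ℂ))) 0 / (Nat.factorial 1 : ℂ) ≠ 0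
  rw [iteratedDeriv_one, Nat.factorial_one, Nat.cast_one, div_one]
  push_cast
  exact deriv_Gamma_div_Gamma_ne_zero m

theorem isRegularScale_real : IsRegularScale ℝ ℂ where
  rfac_ne_zero a := by
    change rfacReal a ≠ 0
    rw [rfacReal]
    split_ifs with h
    · exact rfacInt_ne_zero ℂ _
    · refine Complex.Gamma_ne_zero fun m hm => h ⟨-(m + 1), by omega, ?_⟩
      have h1 : a + 1 = -m := by exact_mod_cast hm
      push_cast
      linarith
  rfac_zero := by
    change rfacReal 0 = 1
    rw [rfacReal, if_neg, Complex.ofReal_zero, zero_add, Complex.Gamma_one]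
    rintro ⟨n, hn, h0⟩
    exact hn.ne (by exact_mod_cast h0)
  rfac_neg_one := by
    change rfacReal (-1) = 1
    rw [rfacReal, if_pos ⟨-1, by norm_num, by norm_num⟩,
      show ⌊(-1 : ℝ)⌋ = -1 by rw [Int.floor_eq_iff]; norm_num]
    simp [rfacInt]
  stirling a := by
    by_cases h : ∃ m : ℕ, a = -(m + 1)
    · obtain ⟨m, rfl⟩ := h
      exact Or.inr (stirling_real_one_ne_zero m)
    · push Not at h
      exact Or.inl (stirling_real_zero_ne_zero h)
  stirling_zero a ha := stirling_real_zero_ne_zero fun m hm => by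
    have : (0 : ℝ) ≤ m := Nat.cast_nonneg m
    linarith

end Scales

/-! ### Expansions from duality. -/

section Expansions

variable {Γ K : Type*} [CommRing Γ] [LinearOrder Γ] [IsStrictOrderedRing Γ]
  [Field K] [CharZero K] [Algebra Γ K] [Scale Γ K]

theorem one_ne_zero_logIndex : one ≠ 0 := Finsupp.single_ne_zero.2 one_ne_zero

/-- `p` is a graded sequence which is dual to the powers `P k`. -/
def IsDualSequence (P : Γ → Op Γ K) (p : LogIndex → Γ → LogExpr Γ K) : Prop :=
  ∃ C : Γ → Op Γ K, (∀ α a, p α a = ofOp α (C a)) ∧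
    ∀ k b, (P k * C b).coeff 0 = if k = b then rfac K b else 0

theorem exists_ofOp_of_isGraded (hΓ : IsRegularScale Γ K) {p : LogIndex → Γ → LogExpr Γ K}
    (hg : IsGraded p) (hn : IsNormalized p) :
    ∃ C : Γ → Op Γ K, (∀ α a, p α a = ofOp α (C a)) ∧
      ∀ a, (C a).coeff 0 = if a = 0 then 1 else 0 := by
  obtain ⟨c, hc, hp⟩ := hg
  choose C _ hC using fun a => exists_eq_ofOp hΓ (hc a).1
  have hpC : ∀ α a, p α a = ofOp α (C a) := fun α a => (hp α a).trans (hC a α)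
  refine ⟨C, hpC, fun a => ?_⟩
  rw [← aug_ofOp hΓ 0, ← hpC]
  split_ifs with h
  · rw [h, (hn 0).1]
  · exact (hn 0).2 a h

theorem act_ofOp_of_ne_zero (hΓ : IsRegularScale Γ K) {α : LogIndex} (hα : α ≠ 0)
    (g C : Op Γ K) : act α g (ofOp α C) = ofOp α (g * C) := by
  rw [act_ofOp hΓ, mask_eq_self hΓ hα]

theorem aug_act_harmLog (hΓ : IsRegularScale Γ K) {α : LogIndex} (hα : α ≠ 0) (g : Op Γ K)
    (b : Γ) : aug α (act α g (harmLog α b)) = rfac K b * g.coeff b := by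
  rw [harmLog_eq_ofOp hΓ, act_ofOp_of_ne_zero hΓ hα, aug_ofOp hΓ, mul_comm g,
    HahnSeries.coeff_single_mul, sub_neg_eq_add, zero_add]

namespace IsPowerFamily

variable {P R : Γ → Op Γ K} (hP : IsPowerFamily P) (hR : IsPowerFamily R)
  (hPR : ∀ a, hP.subst (R a) = HahnSeries.single a 1) (hΓ : IsRegularScale Γ K)
include hR hPR

/-- Write `g` as the substitution of `f = P 1` into `g(f^{(-1)})`; pairing with `C` then isolates
one coefficient. -/
theorem coeff_mul_of_dual {C : Op Γ K} {b : Γ}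
    (hC : ∀ k, (P k * C).coeff 0 = if k = b then rfac K b else 0)
    (hb : rfac K b ≠ 0) (g : Op Γ K) :
    (g * C).coeff 0 = rfac K b * (hR.subst g).coeff b := by
  have h := hP.coeff_subst_mul_dual (E := (rfac K b)⁻¹ • C) (b := b) (fun k => by
    rw [mul_smul', HahnSeries.coeff_smul, hC, smul_eq_mul]
    split_ifs
    · exact inv_mul_cancel₀ hb
    · exact mul_zero _) (hR.subst g)
  rw [hP.subst_subst hR hPR, mul_smul', HahnSeries.coeff_smul, smul_eq_mul] at h
  rw [← h, mul_inv_cancel_left₀ hb]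

include hΓ

theorem aug_act_dual {p : LogIndex → Γ → LogExpr Γ K} (hp : IsDualSequence P p) {α : LogIndex}
    (hα : α ≠ 0) (g : Op Γ K) (b : Γ) :
    aug α (act α g (p α b)) = rfac K b * (hR.subst g).coeff b := by
  obtain ⟨C, hpC, hC⟩ := hp
  rw [hpC, aug_act_ofOp hΓ, mask_eq_self hΓ hα]
  exact hP.coeff_mul_of_dual hR hPR (fun k => hC k b) (hΓ.rfac_ne_zero b) g

theorem aug_act_dual_of_nonneg {p : LogIndex → Γ → LogExpr Γ K} (hp : IsDualSequence P p)
    (α : LogIndex) {g : Op Γ K} (hg : ∀ a, g.coeff a ≠ 0 → 0 ≤ a) (b : Γ) :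
    aug α (act α g (p α b)) = rfac K b * (hR.subst g).coeff b := by
  obtain ⟨C, hpC, hC⟩ := hp
  rw [hpC, aug_act_ofOp hΓ, coeff_mul_mask hΓ α hg]
  exact hP.coeff_mul_of_dual hR hPR (fun k => hC k b) (hΓ.rfac_ne_zero b) g

theorem aug_act_residue (hinj : Function.Injective (algebraMap Γ K)) (g : Op Γ K) (b : Γ) :
    aug one (act one (g * pincherle (P 1) * P (-1 - b)) (harmLog one (-1))) =
      (hR.subst g).coeff b := by
  rw [aug_act_harmLog hΓ one_ne_zero_logIndex, hΓ.rfac_neg_one, one_mul,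
    ← hP.residue_formula hinj (hR.subst g) b, hP.subst_subst hR hPR]

/-- All the expansions of `F = g(f^{(-1)})`, where `f = P 1`. -/
theorem expansions (hinj : Function.Injective (algebraMap Γ K)) (g : Op Γ K) :
    ∃ F : Op Γ K, IsComp g R F ∧
      (∀ p : LogIndex → Γ → LogExpr Γ K, IsDualSequence P p →
        (∀ α : LogIndex, α ≠ 0 →
          HasHSum (fun b : Γ => HahnSeries.single b
            (aug α (act α g (p α b)) / rfac K b)) F) ∧
        ((∀ a, g.coeff a ≠ 0 → 0 ≤ a) →
          HasHSum (fun b : Γ => HahnSeries.single b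
            (aug 0 (act 0 g (p 0 b)) / rfac K b)) F) ∧
        (∀ α : LogIndex, α ≠ 0 → ∀ b : Γ,
          aug α (act α g (p α b)) = aug α (act α F (harmLog α b))) ∧
        (∀ b : Γ, rfac K b * aug one
            (act one (g * pincherle (P 1) * P (-1 - b)) (harmLog one (-1))) =
          aug one (act one g (p one b)))) ∧
      (∀ α : LogIndex, α ≠ 0 →
        HasHSum (fun b : Γ => HahnSeries.single b
          (aug α (act α F (harmLog α b)) / rfac K b)) F) ∧
      HasHSum (fun b : Γ => HahnSeries.single b
        (aug one (act one (g * pincherle (P 1) * P (-1 - b)) (harmLog one (-1))))) F := by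
  refine ⟨hR.subst g, hR.isComp_subst g, fun p hp => ⟨fun α hα => ?_, fun hg => ?_,
    fun α hα b => ?_, fun b => ?_⟩, fun α hα => ?_, ?_⟩
  · refine hasHSum_monomials fun b => ?_
    rw [hP.aug_act_dual hR hPR hΓ hp hα, mul_div_cancel_left₀ _ (hΓ.rfac_ne_zero b)]
  · refine hasHSum_monomials fun b => ?_
    rw [hP.aug_act_dual_of_nonneg hR hPR hΓ hp 0 hg,
      mul_div_cancel_left₀ _ (hΓ.rfac_ne_zero b)]
  · rw [hP.aug_act_dual hR hPR hΓ hp hα, aug_act_harmLog hΓ hα]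
  · rw [hP.aug_act_residue hR hPR hΓ hinj,
      hP.aug_act_dual hR hPR hΓ hp one_ne_zero_logIndex]
  · refine hasHSum_monomials fun b => ?_
    rw [aug_act_harmLog hΓ hα, mul_div_cancel_left₀ _ (hΓ.rfac_ne_zero b)]
  · exact hasHSum_monomials fun b => hP.aug_act_residue hR hPR hΓ hinj g b

theorem hasHSum_power {p : LogIndex → Γ → LogExpr Γ K} (hp : IsDualSequence P p) (a : Γ) :
    HasHSum (fun b : Γ => HahnSeries.single b
      (aug one (act one (HahnSeries.single a 1) (p one b)) / rfac K b)) (R a) := by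
  refine hasHSum_monomials fun b => ?_
  rw [hP.aug_act_dual hR hPR hΓ hp one_ne_zero_logIndex, hR.subst_single, one_smul,
    mul_div_cancel_left₀ _ (hΓ.rfac_ne_zero b)]

end IsPowerFamily

end Expansions

/-! ### The discrete theory. -/

section Discrete

variable {K : Type*} [Field K] [CharZero K]

theorem injective_algebraMap_int : Function.Injective (algebraMap ℤ K) := by
  intro a b h
  simpa using h

theorem rfacInt_eq_mul (b : ℤ) :
    rfacInt K b = (if b = 0 then 1 else (b : K)) * rfacInt K (b - 1) := by
  rcases lt_trichotomy b 0 with hb | rfl | hb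
  · obtain ⟨m, rfl⟩ : ∃ m : ℕ, b = -(m + 1) := ⟨(-b - 1).toNat, by omega⟩
    rw [rfacInt, rfacInt, if_neg (by omega), if_neg (by omega), if_neg (by omega),
      show (-(-((m : ℤ) + 1)) - 1).toNat = m by omega,
      show (-(-((m : ℤ) + 1) - 1) - 1).toNat = m + 1 by omega,
      show (-((m : ℤ) + 1) + 1) = (-((m : ℤ) + 1) - 1 + 1) + 1 by ring,
      zpow_add_one₀ (neg_ne_zero.2 (one_ne_zero' K)), Nat.factorial_succ]
    have h1 := Nat.cast_add_one_ne_zero (R := K) m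
    have h2 : (m.factorial : K) ≠ 0 := Nat.cast_ne_zero.2 m.factorial_ne_zero
    push_cast
    field_simp
  · simp [rfacInt]
  · obtain ⟨m, rfl⟩ : ∃ m : ℕ, b = m + 1 := ⟨(b - 1).toNat, by omega⟩
    rw [rfacInt, rfacInt, if_pos hb.le, if_neg hb.ne', if_pos (by omega),
      show ((m : ℤ) + 1).toNat = m + 1 by omega, show ((m : ℤ) + 1 - 1).toNat = m by omega,
      Nat.factorial_succ]
    push_cast
    ring

theorem zpow_mul_of_mul_eq {f : Op ℤ K} (hf : f ≠ 0) {E : ℤ → Op ℤ K}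
    (hE : ∀ b, f * E b = E (b - 1)) (k b : ℤ) : f ^ k * E b = E (b - k) := by
  induction k using Int.induction_on generalizing b with
  | zero => rw [zpow_zero, one_mul, sub_zero]
  | succ n ih => rw [zpow_add_one₀ hf, mul_assoc, hE, ih, sub_sub, add_comm]
  | pred n ih =>
    have h := hE (b + 1)
    rw [add_sub_cancel_right] at h
    rw [zpow_sub_one₀ hf, mul_assoc, ← h, inv_mul_cancel_left₀ hf, ih]
    congr 1
    ring

theorem IsAssociatedDiscrete.isDualSequence {f : Op ℤ K} (hf : IsDelta f)
    {p : LogIndex → ℤ → LogExpr ℤ K} (hp : IsAssociatedDiscrete f p) :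
    IsDualSequence (fun a : ℤ => f ^ a) p := by
  have hΓ := isRegularScale_int K
  obtain ⟨hg, hn, hact⟩ := hp
  obtain ⟨C, hpC, hC0⟩ := exists_ofOp_of_isGraded hΓ hg hn
  have hfC : ∀ b, f * C b = (if b = 0 then (1 : K) else (b : K)) • C (b - 1) := by
    intro b
    refine ofOp_injective hΓ one_ne_zero_logIndex ?_
    have h := hact one one_ne_zero_logIndex b
    rwa [hpC, hpC, act_ofOp_of_ne_zero hΓ one_ne_zero_logIndex, smul_ofOp] at h
  have hE : ∀ b, f * ((rfacInt K b)⁻¹ • C b) = (rfacInt K (b - 1))⁻¹ • C (b - 1) := by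
    intro b
    have h1 := rfacInt_ne_zero K b
    rw [rfacInt_eq_mul] at h1
    -- Dividing by `⌊b⌉!` turns the recurrence into a pure shift, which then iterates to every
    -- integral power of `f`.
    rw [mul_smul', hfC, smul_smul, rfacInt_eq_mul b, mul_inv, mul_assoc, mul_comm,
      mul_assoc, mul_inv_cancel₀ (left_ne_zero_of_mul h1), mul_one]
  refine ⟨C, hpC, fun k b => ?_⟩
  have h := congrArg (fun z => rfacInt K b * z.coeff 0) (zpow_mul_of_mul_eq hf.1 hE k b)
  simp only [mul_smul', HahnSeries.coeff_smul, smul_eq_mul, hC0, sub_eq_zero] at h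
  rw [mul_inv_cancel_left₀ (rfacInt_ne_zero K b)] at h
  rw [h]
  by_cases hkb : k = b
  · subst hkb
    simp [rfacInt, rfac, Scale.rfac]
  · rw [if_neg hkb, if_neg (Ne.symm hkb), mul_zero, mul_zero]

theorem lead_zpow {f : Op ℤ K} (hf : IsDelta f) (a : ℤ) :
    (f ^ a).coeff a = (f.coeff 1) ^ a := by
  have hP := isPowerFamily_zpow hf
  have h0 := hf.coeff_one_ne_zero
  have hadd : ∀ a, (f ^ (a + 1)).coeff (a + 1) = (f ^ a).coeff a * f.coeff 1 := fun a => by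
    simpa using hP.lead_add a 1
  induction a using Int.induction_on with
  | zero => simp
  | succ n ih => rw [hadd, ih, zpow_add_one₀ h0]
  | pred n ih =>
    refine mul_right_cancel₀ h0 ?_
    rw [← hadd, sub_add_cancel, ih, zpow_sub_one₀ h0, inv_mul_cancel_right₀ h0]

theorem IsInverseDiscrete.subst_zpow {f h : Op ℤ K} (hf : IsDelta f) (hh : IsDelta h)
    (hfh : (isPowerFamily_zpow hf).subst h = D) (a : ℤ) :
    (isPowerFamily_zpow hf).subst (h ^ a) = HahnSeries.single a 1 := by
  have hc := ((isPowerFamily_zpow hf).isDelta_of_subst_eq_D hfh).2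
  rw [zpow_one] at hc
  refine (isPowerFamily_zpow hf).subst_inverse_apply (isPowerFamily_zpow hh)
    injective_algebraMap_int (by rwa [zpow_one]) (fun a => ?_) a
  rw [lead_zpow hf, lead_zpow hh, ← mul_zpow, hc, one_zpow]

theorem existsUnique_inverse_discrete {f : Op ℤ K} (hf : IsDelta f) :
    ∃! h : Op ℤ K, IsInverseDiscrete f h := by
  have hP := isPowerFamily_zpow hf
  obtain ⟨h, hh⟩ := hP.subst_surjective D
  have hd := (hP.isDelta_of_subst_eq_D hh).1
  have hR := isPowerFamily_zpow hd
  refine ⟨h, ⟨hd, ?_, ?_⟩, fun h' hh' => ?_⟩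
  · rw [← hh]
    exact hP.isComp_subst h
  -- Since `D` is sent to `f`, the reverse composition evaluated at `D` is the second equation `f(h)
  -- = D`.
  · have h1 := hP.subst_subst' hR (IsInverseDiscrete.subst_zpow hf hd hh) D
    rw [hP.subst_D, zpow_one] at h1
    have h2 := hR.isComp_subst f
    rwa [h1] at h2
  · exact hP.subst_injective ((hP.eq_subst_of_isComp hh'.2.1).symm.trans hh.symm)

end Discrete

/-! ### The continuous theory. -/

section Continuous

theorem injective_algebraMap_real : Function.Injective (algebraMap ℝ ℂ) :=
  Complex.ofReal_injective

theorem IsAssociated.isDualSequence {f : Op ℝ ℂ} {n : ℤ} {p : LogIndex → ℝ → LogExpr ℝ ℂ}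
    (hp : IsAssociated f n p) : IsDualSequence (rpow f n) p := by
  have hΓ := isRegularScale_real
  obtain ⟨hg, hn, hact⟩ := hp
  obtain ⟨C, hpC, hC0⟩ := exists_ofOp_of_isGraded hΓ hg hn
  refine ⟨C, hpC, fun k b => ?_⟩
  have h := hact one one_ne_zero_logIndex b k
  rw [hpC, hpC, act_ofOp_of_ne_zero hΓ one_ne_zero_logIndex, smul_ofOp] at h
  rw [ofOp_injective hΓ one_ne_zero_logIndex h, HahnSeries.coeff_smul, smul_eq_mul, hC0]
  by_cases hkb : k = b
  · rw [hkb, sub_self, if_pos rfl, if_pos rfl, hΓ.rfac_zero, div_one, mul_one]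
  · rw [if_neg (sub_ne_zero.2 (Ne.symm hkb)), if_neg hkb, mul_zero]

theorem subst_rpow {f h : Op ℝ ℂ} {n m : ℤ} (hf : IsDelta f) (hh : IsDelta h)
    (hlog : leadLog h m = -leadLog f n) (hfh : (isPowerFamily_rpow hf n).subst h = D) (a : ℝ) :
    (isPowerFamily_rpow hf n).subst (rpow h m a) = HahnSeries.single a 1 := by
  refine (isPowerFamily_rpow hf n).subst_inverse_apply (isPowerFamily_rpow hh m)
    injective_algebraMap_real (by rwa [rpow_one hh]) (fun a => ?_) a
  rw [coeff_rpow_self hf, coeff_rpow_self hh, ← Complex.exp_add, hlog, mul_neg, neg_add_cancel,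
    Complex.exp_zero]

theorem leadLog_injective (h : Op ℝ ℂ) : Function.Injective (leadLog h) := by
  intro m m' hmm
  have h2 := mul_left_cancel₀ Complex.two_pi_I_ne_zero (add_left_cancel hmm)
  exact_mod_cast h2

/-- Both sides are logarithms of the same number, so they differ by a multiple of `2πi`, which `m`
absorbs. -/
theorem exists_leadLog_eq_neg {f h : Op ℝ ℂ} (hf : f ≠ 0) (hh : h ≠ 0) (n : ℤ)
    (hfh : h.leadingCoeff * f.leadingCoeff = 1) : ∃ m : ℤ, leadLog h m = -leadLog f n := by
  have h1 : Complex.exp (-leadLog f n) = Complex.exp (leadLog h 0) := by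
    rw [Complex.exp_neg, exp_leadLog hf, exp_leadLog hh]
    exact (eq_inv_of_mul_eq_one_left hfh).symm
  obtain ⟨m, hm⟩ := Complex.exp_eq_exp_iff_exists_int.1 h1
  refine ⟨m, ?_⟩
  rw [hm, leadLog, leadLog]
  push_cast
  ring

theorem existsUnique_inverse {f : Op ℝ ℂ} (hf : IsDelta f) (n : ℤ) :
    ∃! hm : Op ℝ ℂ × ℤ, IsInverse f n hm.1 hm.2 := by
  have hP := isPowerFamily_rpow hf n
  obtain ⟨h, hh⟩ := hP.subst_surjective D
  obtain ⟨hd, hc⟩ := hP.isDelta_of_subst_eq_D hh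
  rw [rpow_one hf, ← hd.leadingCoeff_eq, ← hf.leadingCoeff_eq] at hc
  obtain ⟨m, hm⟩ := exists_leadLog_eq_neg hf.1 hd.1 n hc
  have hR := isPowerFamily_rpow hd m
  refine ⟨(h, m), ⟨hd, hm, ?_, ?_⟩, ?_⟩
  · rw [← hh]
    exact hP.isComp_subst h
  · have h1 := hP.subst_subst' hR (subst_rpow hf hd hm hh) D
    rw [hP.subst_D, rpow_one hf] at h1
    have h2 := hR.isComp_subst f
    rwa [h1] at h2
  · rintro ⟨h', m'⟩ ⟨-, hm', hh', -⟩
    obtain rfl : h' = h :=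
      hP.subst_injective ((hP.eq_subst_of_isComp hh').symm.trans hh.symm)
    exact Prod.ext rfl (leadLog_injective h' (hm'.trans hm.symm))

end Continuous

end RomanLog

end

theorem mainTheorem8 :
    -- Discrete case
    (∀ (K : Type*) [Field K] [CharZero K] (f : RomanLog.Op ℤ K), RomanLog.IsDelta f →
      (∃! h : RomanLog.Op ℤ K, RomanLog.IsInverseDiscrete f h) ∧
      ∀ h : RomanLog.Op ℤ K, RomanLog.IsInverseDiscrete f h →
        -- the expansions of `F = g(f^{(-1)})`
        (∀ g : RomanLog.Op ℤ K, ∃ F : RomanLog.Op ℤ K,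
          RomanLog.IsComp g (fun a => h ^ a) F ∧
          (∀ p : RomanLog.LogIndex → ℤ → RomanLog.LogExpr ℤ K,
            RomanLog.IsAssociatedDiscrete f p →
            (∀ α : RomanLog.LogIndex, α ≠ 0 →
              RomanLog.HasHSum (fun b : ℤ => HahnSeries.single b
                (RomanLog.aug α (RomanLog.act α g (p α b)) / RomanLog.rfac K b)) F) ∧
            ((∀ a, g.coeff a ≠ 0 → 0 ≤ a) →
              RomanLog.HasHSum (fun b : ℤ => HahnSeries.single b
                (RomanLog.aug 0 (RomanLog.act 0 g (p 0 b)) / RomanLog.rfac K b)) F) ∧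
            (∀ α : RomanLog.LogIndex, α ≠ 0 → ∀ b : ℤ,
              RomanLog.aug α (RomanLog.act α g (p α b)) =
                RomanLog.aug α (RomanLog.act α F (RomanLog.harmLog α b))) ∧
            (∀ b : ℤ, RomanLog.rfac K b * RomanLog.aug RomanLog.one
                (RomanLog.act RomanLog.one (g * RomanLog.pincherle f * f ^ (-1 - b))
                  (RomanLog.harmLog RomanLog.one (-1))) =
              RomanLog.aug RomanLog.one (RomanLog.act RomanLog.one g (p RomanLog.one b)))) ∧
          (∀ α : RomanLog.LogIndex, α ≠ 0 →
            RomanLog.HasHSum (fun b : ℤ => HahnSeries.single b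
              (RomanLog.aug α (RomanLog.act α F (RomanLog.harmLog α b)) /
                RomanLog.rfac K b)) F) ∧
          RomanLog.HasHSum (fun b : ℤ => HahnSeries.single b
            (RomanLog.aug RomanLog.one
              (RomanLog.act RomanLog.one (g * RomanLog.pincherle f * f ^ (-1 - b))
                (RomanLog.harmLog RomanLog.one (-1))))) F) ∧
        -- the expansion of the powers of `f^{(-1)}`
        (∀ p : RomanLog.LogIndex → ℤ → RomanLog.LogExpr ℤ K,
          RomanLog.IsAssociatedDiscrete f p → ∀ a : ℤ,
            RomanLog.HasHSum (fun b : ℤ => HahnSeries.single b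
              (RomanLog.aug RomanLog.one
                (RomanLog.act RomanLog.one (HahnSeries.single a 1) (p RomanLog.one b)) /
                  RomanLog.rfac K b)) (h ^ a))) ∧
    -- Continuous case
    (∀ (f : RomanLog.Op ℝ ℂ) (n : ℤ), RomanLog.IsDelta f →
      (∃! hm : RomanLog.Op ℝ ℂ × ℤ, RomanLog.IsInverse f n hm.1 hm.2) ∧
      ∀ (h : RomanLog.Op ℝ ℂ) (m : ℤ), RomanLog.IsInverse f n h m →
        -- the expansions of `F = g(f^{(-1;n)})`
        (∀ g : RomanLog.Op ℝ ℂ, ∃ F : RomanLog.Op ℝ ℂ,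
          RomanLog.IsComp g (RomanLog.rpow h m) F ∧
          (∀ p : RomanLog.LogIndex → ℝ → RomanLog.LogExpr ℝ ℂ,
            RomanLog.IsAssociated f n p →
            (∀ α : RomanLog.LogIndex, α ≠ 0 →
              RomanLog.HasHSum (fun b : ℝ => HahnSeries.single b
                (RomanLog.aug α (RomanLog.act α g (p α b)) / RomanLog.rfac ℂ b)) F) ∧
            ((∀ a, g.coeff a ≠ 0 → 0 ≤ a) →
              RomanLog.HasHSum (fun b : ℝ => HahnSeries.single b
                (RomanLog.aug 0 (RomanLog.act 0 g (p 0 b)) / RomanLog.rfac ℂ b)) F) ∧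
            (∀ α : RomanLog.LogIndex, α ≠ 0 → ∀ b : ℝ,
              RomanLog.aug α (RomanLog.act α g (p α b)) =
                RomanLog.aug α (RomanLog.act α F (RomanLog.harmLog α b))) ∧
            (∀ b : ℝ, RomanLog.rfac ℂ b * RomanLog.aug RomanLog.one
                (RomanLog.act RomanLog.one
                  (g * RomanLog.pincherle f * RomanLog.rpow f n (-1 - b))
                  (RomanLog.harmLog RomanLog.one (-1))) =
              RomanLog.aug RomanLog.one (RomanLog.act RomanLog.one g (p RomanLog.one b)))) ∧
          (∀ α : RomanLog.LogIndex, α ≠ 0 →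
            RomanLog.HasHSum (fun b : ℝ => HahnSeries.single b
              (RomanLog.aug α (RomanLog.act α F (RomanLog.harmLog α b)) /
                RomanLog.rfac ℂ b)) F) ∧
          RomanLog.HasHSum (fun b : ℝ => HahnSeries.single b
            (RomanLog.aug RomanLog.one
              (RomanLog.act RomanLog.one
                (g * RomanLog.pincherle f * RomanLog.rpow f n (-1 - b))
                (RomanLog.harmLog RomanLog.one (-1))))) F) ∧
        -- the expansion of the powers of `f^{(-1;n)}`
        (∀ p : RomanLog.LogIndex → ℝ → RomanLog.LogExpr ℝ ℂ,
          RomanLog.IsAssociated f n p → ∀ a : ℝ,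
            RomanLog.HasHSum (fun b : ℝ => HahnSeries.single b
              (RomanLog.aug RomanLog.one
                (RomanLog.act RomanLog.one (HahnSeries.single a 1) (p RomanLog.one b)) /
                  RomanLog.rfac ℂ b)) (RomanLog.rpow h m a))) := by
  refine ⟨fun K _ _ f hf => ⟨RomanLog.existsUnique_inverse_discrete hf, fun h hh => ?_⟩,
    fun f n hf => ⟨RomanLog.existsUnique_inverse hf n, fun h m hh => ?_⟩⟩
  · have hP := RomanLog.isPowerFamily_zpow hf
    have hR := RomanLog.isPowerFamily_zpow hh.1
    have hPR := RomanLog.IsInverseDiscrete.subst_zpow hf hh.1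
      (hP.eq_subst_of_isComp hh.2.1).symm
    have hΓ := RomanLog.isRegularScale_int K
    refine ⟨fun g => ?_, fun p hp => hP.hasHSum_power hR hPR hΓ (hp.isDualSequence hf)⟩
    obtain ⟨F, hF, hdual, hrest⟩ :=
      hP.expansions hR hPR hΓ RomanLog.injective_algebraMap_int g
    -- The general statement speaks of `P 1`, which here is `f ^ 1`.
    simp only [zpow_one] at hdual hrest
    exact ⟨F, hF, fun p hp => hdual p (hp.isDualSequence hf), hrest⟩
  · have hP := RomanLog.isPowerFamily_rpow hf n
    have hR := RomanLog.isPowerFamily_rpow hh.1 m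
    have hPR := RomanLog.subst_rpow hf hh.1 hh.2.1 (hP.eq_subst_of_isComp hh.2.2.1).symm
    have hΓ := RomanLog.isRegularScale_real
    refine ⟨fun g => ?_, fun p hp => hP.hasHSum_power hR hPR hΓ hp.isDualSequence⟩
    obtain ⟨F, hF, hdual, hrest⟩ :=
      hP.expansions hR hPR hΓ RomanLog.injective_algebraMap_real g
    simp only [RomanLog.rpow_one hf] at hdual hrest
    exact ⟨F, hF, fun p hp => hdual p hp.isDualSequence, hrest⟩
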